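/- Let $n\ge 0$, $\mu>0$. Let $A$ be exponential with rate $\mu$, and let $B$ have a polynomial distribution on $[0,1]$: $F_B(x)=0$ for $x<0$, $F_B(x)=\sum_{i=0}^n c_i x^i$ for $0\le x\le 1$ and $F_B(x)=1$ for $x\ge 1$, where $c_i\in\mathbb R$ and $\sum_{i=0}^n c_i=1$. A steady-state waiting time is a random variable $W$, independent of the independent pair $(A,B)$, such that $\max\{0,B-A-W\}$ has the same distribution as $W$. Put $$\nu_k=\mu\sum_{i=0}^{k}\frac{(i+n-k)!}{i!}\,c_{i+n-k}\qquad(0\le k\le n),$$ and assume that all complex roots of the characteristic polynomial $$r^{2n}(r^2-\mu^2)+(-1)^n\Big(\sum_{i=0}^{n-1}\nu_i r^i\Big)\Big(\sum_{j=0}^{n-1}\nu_j(-r)^j\Big)$$ are simple. Then its roots are nonzero and can be labelled $r_1,\dots,r_{2n+2}$ with $r_{2n+3-i}=-r_i$, and for each $i$ the linear system $$\zeta_i r_i^{n+1}=\mu\zeta_i r_i^n+\sum_{k=0}^{n-1}\nu_k\theta_i r_i^k,\qquad \theta_i r_i^{n+1}=-\mu\theta_i r_i^n+\sum_{k=0}^{n-1}\nu_k(-1)^{n+1+k}\zeta_i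 r_i^k$$ has a solution $(\zeta_i,\theta_i)\neq(0,0)$. Fix any such labelling and solutions. The distribution of the steady-state waiting time $W$ exists and is unique. It has an atom $\pi_0=\mathbb P[W=0]>0$ at $0$ and is otherwise absolutely continuous and concentrated on $[0,1]$; there are $d_1,\dots,d_{2n+2}\in\mathbb C$ such that its density is $$f_W(x)=\sum_{i=1}^{2n+2}d_i\zeta_i e^{r_i x}\ \ (\ge 0),\qquad 0\le x\le 1,$$ and $$\pi_0=1-\sum_{i=1}^{2n+2}\frac{d_i\zeta_i}{r_i}\,(e^{r_i}-1).$$ With $f=f_W$ given by this sum of exponentials, the $d_i$ and $\pi_0$ satisfy the following linear system: - relations: $d_i\zeta_i r_i^n(r_i-\mu)=e^{-r_i}d_{2n+3-i}\zeta_{2n+3-i}\sum_{j=0}^{n-1}\nu_j r_i^j$ for $1\le i\le 2n+2$; - initial conditions: $f(0)=\mu\pi_0-\mu\pi_0c_0-\mu\sum_{i=0}^n c_i\int_0^1y^if(y)\,dy$ and, for $1\le \ell\le n$, $$\begin{aligned}f^{(\ell)}(0)={}&\mu f^{(\ell-1)}(0)-\mu\pi_0\,\ell!\,c_\ell-\mu(-1)^{\ell-1}f^{(\ell-1)}(1)-\mu\sum_{i=0}^{n-\ell}c_{i+\ell}\frac{(i+\ell)!}{i!}\int_0^1y^if(y)\,dy\\&+\sum_{j=0}^{\ell-1}\nu_{n-j}(-1)^{\ell-1-j}f^{(\ell-1-j)}(1);\end{aligned}$$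 - normalisation: $\pi_0=1-\int_0^1f(x)\,dx$. This system determines $\pi_0$ and the products $d_i\zeta_i$ uniquely: every complex solution of it has the same $\pi_0$ and the same $d_i\zeta_i$, $1\le i\le 2n+2$. -/

import Mathlib

open MeasureTheory ProbabilityTheory Polynomial

noncomputable section

namespace AlternatingLindley

/-- `β` is a polynomial distribution on `[0,1]` with coefficients `c 0, …, c n`: its distribution
function is `∑ i ≤ n, c i * x ^ i` on `[0,1]`, vanishes on the negative half line and equals `1`
from `1` on. An atom `c 0` at the origin is allowed. -/
structure IsPolynomialDistribution (n : ℕ) (c : ℕ → ℝ) (β : Measure ℝ) : Prop where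
  isProbabilityMeasure : IsProbabilityMeasure β
  sum_coeff : ∑ i ∈ Finset.range (n + 1), c i = 1
  cdf_of_neg : ∀ x : ℝ, x < 0 → cdf β x = 0
  cdf_of_mem : ∀ x ∈ Set.Icc (0 : ℝ) 1, cdf β x = ∑ i ∈ Finset.range (n + 1), c i * x ^ i
  cdf_of_ge : ∀ x : ℝ, 1 ≤ x → cdf β x = 1

/-- `w` is a steady-state law of the waiting time: if `A` is exponential with rate `μ`, `B` has law
`β`, `W` has law `w` and the three are independent, then `max {0, B - A - W}` has law `w`. -/
structure IsSteadyState (μ : ℝ) (β w : Measure ℝ) : Prop where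
  isProbabilityMeasure : IsProbabilityMeasure w
  map_eq : Measure.map (fun p : (ℝ × ℝ) × ℝ => max 0 (p.1.2 - p.1.1 - p.2))
    (((expMeasure μ).prod β).prod w) = w

/-- `ν_k = μ * ∑_{i=0}^{k} (i + n - k)! / i! * c_{i + n - k}`, used for `k ≤ n` only. -/
def nu (n : ℕ) (c : ℕ → ℝ) (μ : ℝ) (k : ℕ) : ℝ :=
  μ * ∑ i ∈ Finset.range (k + 1),
    ((i + (n - k)).factorial : ℝ) / (i.factorial : ℝ) * c (i + (n - k))

/-- The polynomial `∑_{i=0}^{n-1} ν_i r^i` in `r`. -/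
def nuPoly (n : ℕ) (c : ℕ → ℝ) (μ : ℝ) : ℂ[X] :=
  ∑ i ∈ Finset.range n, C (nu n c μ i : ℂ) * X ^ i

/-- The characteristic polynomial
`r^(2n) (r² - μ²) + (-1)^n (∑_{i<n} ν_i r^i) (∑_{j<n} ν_j (-r)^j)`. -/
def charPoly (n : ℕ) (c : ℕ → ℝ) (μ : ℝ) : ℂ[X] :=
  X ^ (2 * n) * (X ^ 2 - C ((μ : ℂ) ^ 2)) +
    (-1) ^ n * (nuPoly n c μ * (nuPoly n c μ).comp (-X))

/-- `r` lists `2n+2` distinct roots of the characteristic polynomial (hence all of them), ordered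
so that opposite positions carry opposite roots, and `(ζ i, θ i)` is a nontrivial solution of the
`2 × 2` linear system at the root `r i`. -/
structure IsCharacteristicData (n : ℕ) (c : ℕ → ℝ) (μ : ℝ) (r ζ θ : Fin (2 * n + 2) → ℂ) :
    Prop where
  injective : Function.Injective r
  isRoot : ∀ i, (charPoly n c μ).IsRoot (r i)
  rev : ∀ i, r i.rev = -r i
  nontrivial : ∀ i, ζ i ≠ 0 ∨ θ i ≠ 0
  first : ∀ i, ζ i * r i ^ (n + 1) =
    μ * ζ i * r i ^ n + ∑ k ∈ Finset.range n, (nu n c μ k : ℂ) * θ i * r i ^ k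
  second : ∀ i, θ i * r i ^ (n + 1) =
    -μ * θ i * r i ^ n +
      ∑ k ∈ Finset.range n, (nu n c μ k : ℂ) * (-1) ^ (n + 1 + k) * ζ i * r i ^ k

/-- The `l`-th derivative at `x` of the exponential sum `∑ i, d i * ζ i * e^(r i * x)`; the sum
itself is the case `l = 0`. -/
def expSum {n : ℕ} (r ζ d : Fin (2 * n + 2) → ℂ) (l : ℕ) (x : ℝ) : ℂ :=
  ∑ i, d i * ζ i * r i ^ l * Complex.exp (r i * x)

/-- The linear system for the coefficients `d` and the mass `p` at the origin, with
`f = expSum r ζ d 0`: the relations between `d i` and the coefficient of the opposite root, the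
`n + 1` initial conditions at `x = 0`, and the normalisation. -/
structure SolvesLinearSystem (n : ℕ) (c : ℕ → ℝ) (μ : ℝ) (r ζ d : Fin (2 * n + 2) → ℂ) (p : ℂ) :
    Prop where
  relation : ∀ i, d i * ζ i * r i ^ n * (r i - μ) =
    Complex.exp (-r i) * d i.rev * ζ i.rev * ∑ j ∈ Finset.range n, (nu n c μ j : ℂ) * r i ^ j
  initial_zero : expSum r ζ d 0 0 =
    μ * p - μ * p * c 0 -
      μ * ∑ i ∈ Finset.range (n + 1), (c i : ℂ) * ∫ y in (0 : ℝ)..1, (y : ℂ) ^ i * expSum r ζ d 0 y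
  initial : ∀ l ∈ Finset.Icc 1 n, expSum r ζ d l 0 =
    (μ * expSum r ζ d (l - 1) 0 - μ * p * ((l.factorial : ℂ) * c l) -
        μ * (-1) ^ (l - 1) * expSum r ζ d (l - 1) 1 -
        μ * ∑ i ∈ Finset.range (n - l + 1),
          (c (i + l) : ℂ) * (((i + l).factorial : ℂ) / (i.factorial : ℂ)) *
            ∫ y in (0 : ℝ)..1, (y : ℂ) ^ i * expSum r ζ d 0 y) +
      ∑ j ∈ Finset.range l,
        (nu n c μ (n - j) : ℂ) * (-1) ^ (l - 1 - j) * expSum r ζ d (l - 1 - j) 1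
  normalisation : p = 1 - ∫ x in (0 : ℝ)..1, expSum r ζ d 0 x

end AlternatingLindley

end

/-!
The law of the next waiting time, given that the present one is `s ∈ [0,1]`, is a density
`x ↦ κ (x + s)` on `(0,1]` plus an atom at `0`, where `κ` is the density of `B - A` on the positive
half line (`gapKernel`). A steady state is therefore an atom `p` at `0` and a continuous density `f`
with `f x = p * κ x + ∫ s in 0..1, κ (x + s) * f s` on `[0,1]` and `p + ∫ f = 1`
(`IsSteadyState.eq_dirac_add_withDensity`, `IsSteadyState.stepDensity_eq`).

This integral equation has at most one solution, even among complex ones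
(`eq_zero_of_integral_equation`): since `A ≥ 1` forces the next waiting time to be `0`, every row
of the transition has an atom of mass at least `e^{-μ}` at the origin, so that the transition
contracts the total variation of laws of total mass zero. The same lower bound gives an invariant
law as a geometric series (`exists_invariant`).

The exponential sums are compared with the integral equation in one direction only. If the
coefficients satisfy the linear system, then the relations make the derivative of order `n` of the
defect of `f' = μ f - μ (p F' + ∫ s in 0..1-x, F' (x + s) * f s)` vanish, `F` being the distribution
polynomial, and the initial conditions make the lower derivatives vanish at `0`; the condition on
`f 0` amounts to `f 1 = 0`. So `(p, f)` solves the integral equation (`gapKernel_equation`).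
By uniqueness of its solution and by linear independence of the exponentials, the linear system
determines the products `d i * ζ i` and `p`. For a pair of opposite roots the determinant of the two
relations is the characteristic polynomial, up to sign, so the relations leave one parameter for
each of the `n + 1` pairs. With `p` there are as many unknowns as remaining equations, and
uniqueness implies that the system is solvable (`IsPolynomialDistribution.exists_systemMap_eq`). Its solution
is the density and the atom of the steady state. No regularity of the steady density beyond
continuity is needed.
-/

noncomputable section

namespace AlternatingLindley

/-! ### Differentiating truncated correlations -/

/-- If `f` is an exponential then `∫ s in 0..1-y, P (y + s) * f s` equals
`f (-y) * ∫ u in y..1, P u * f u`, and solves a first-order linear equation in `y`. -/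
theorem hasDerivAt_integral_shift_mul_of_continuous {𝕜 : Type*} [RCLike 𝕜] {P f : ℝ → 𝕜} {r : 𝕜}
    (hP : Continuous P) (hf : ∀ x, HasDerivAt f (r * f x) x)
    (hmul : ∀ u v, f (u + v) = f u * f v) (y : ℝ) :
    HasDerivAt (fun y : ℝ => ∫ s in (0 : ℝ)..(1 - y), P (y + s) * f s)
      (-(r * ∫ s in (0 : ℝ)..(1 - y), P (y + s) * f s) - P y * f 0) y := by
  have cf : Continuous f := continuous_iff_continuousAt.2 fun x => (hf x).continuousAt
  have hJ : ∀ y : ℝ, ∫ s in (0 : ℝ)..(1 - y), P (y + s) * f s =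
      f (-y) * ∫ u in y..1, P u * f u := by
    intro y
    have h := intervalIntegral.integral_comp_add_left (a := 0) (b := 1 - y)
      (fun u => P u * f (u - y)) y
    simp only [add_sub_cancel_left, add_zero, add_sub_cancel] at h
    rw [h, ← intervalIntegral.integral_const_mul]
    congr 1
    funext u
    rw [sub_eq_neg_add, hmul]
    ring
  have h1 : HasDerivAt (fun y : ℝ => f (-y)) (-(r * f (-y))) y := by
    simpa [Function.comp_def] using (hf (-y)).scomp y (hasDerivAt_neg y)
  have cPf : Continuous fun u => P u * f u := by fun_prop
  have h2 : HasDerivAt (fun y : ℝ => ∫ u in y..1, P u * f u) (-(P y * f y)) y :=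
    intervalIntegral.integral_hasDerivAt_left (cPf.intervalIntegrable _ _)
      (cPf.stronglyMeasurableAtFilter _ _) cPf.continuousAt
  rw [funext hJ]
  refine (h1.mul h2).congr_deriv ?_
  have h0 : f (-y) * f y = f 0 := by rw [← hmul]; simp
  rw [hJ]
  linear_combination (-(P y)) * h0

/-- The Leibniz rule for `y ↦ ∫ s in 0..1-y, P (y + s) * f s` when `f` is an exponential: an
integration by parts brings `hasDerivAt_integral_shift_mul_of_continuous` into this form. -/
theorem hasDerivAt_integral_shift_mul {𝕜 : Type*} [RCLike 𝕜] {P P' f : ℝ → 𝕜} {r : 𝕜}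
    (hP : ∀ x, HasDerivAt P (P' x) x) (hP' : Continuous P')
    (hf : ∀ x, HasDerivAt f (r * f x) x) (hmul : ∀ u v, f (u + v) = f u * f v) (y : ℝ) :
    HasDerivAt (fun y : ℝ => ∫ s in (0 : ℝ)..(1 - y), P (y + s) * f s)
      ((∫ s in (0 : ℝ)..(1 - y), P' (y + s) * f s) - P 1 * f (1 - y)) y := by
  have cP : Continuous P := continuous_iff_continuousAt.2 fun x => (hP x).continuousAt
  have cf : Continuous f := continuous_iff_continuousAt.2 fun x => (hf x).continuousAt
  have h := intervalIntegral.integral_eq_sub_of_hasDerivAt (a := 0) (b := 1 - y)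
    (f := fun s => P (y + s) * f s) (f' := fun s => P' (y + s) * f s + r * (P (y + s) * f s))
    (fun s _ => by
      have h1 : HasDerivAt (fun s => P (y + s)) (P' (y + s)) s := (hP (y + s)).comp_const_add y s
      exact (h1.mul (hf s)).congr_deriv (by ring))
    ((by fun_prop : Continuous fun s => P' (y + s) * f s + r * (P (y + s) * f s)).intervalIntegrable
      _ _)
  rw [intervalIntegral.integral_add
    ((by fun_prop : Continuous fun s => P' (y + s) * f s).intervalIntegrable _ _)
    ((by fun_prop : Continuous fun s => r * (P (y + s) * f s)).intervalIntegrable _ _),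
    intervalIntegral.integral_const_mul] at h
  simp only [add_sub_cancel, add_zero] at h
  refine (hasDerivAt_integral_shift_mul_of_continuous cP hf hmul y).congr_deriv ?_
  rw [eq_sub_of_add_eq h]
  ring

/-! ### Uniqueness for the integral equation -/

/-- For a nonnegative kernel `κ (x + s)` whose mass `∫ κ (x + s) dx` stays below some `q < 1`, a
signed law `p δ₀ + f dx` on `[0,1]` of total mass zero that is fixed by the transition
`s ↦ κ (x + s) dx + (1 - ∫ κ (x + s) dx) δ₀` vanishes: from every starting point the transition
puts at least `1 - q` on the origin, so that on laws of total mass zero it contracts the total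
variation by the factor `q`. -/
theorem eq_zero_of_integral_equation {κ : ℝ → ℝ} (hκ : Continuous κ) (hκ0 : ∀ x, 0 ≤ κ x) {q : ℝ}
    (hq1 : q < 1) (hq : ∀ s ∈ Set.Icc (0 : ℝ) 1, ∫ x in (0 : ℝ)..1, κ (x + s) ≤ q)
    {f : ℝ → ℂ} (hf : Continuous f) {p : ℂ}
    (heq : ∀ x ∈ Set.Icc (0 : ℝ) 1, f x = p * κ x + ∫ s in (0 : ℝ)..1, κ (x + s) * f s)
    (hm : p + ∫ x in (0 : ℝ)..1, f x = 0) :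
    p = 0 ∧ ∀ x ∈ Set.Icc (0 : ℝ) 1, f x = 0 := by
  set K : ℝ → ℝ := fun s => ∫ x in (0 : ℝ)..1, κ (x + s) with hK
  have cK : Continuous K := by
    apply intervalIntegral.continuous_parametric_intervalIntegral_of_continuous' (by fun_prop)
  have hf' : ∫ x in (0 : ℝ)..1, f x = p * K 0 + ∫ s in (0 : ℝ)..1, K s * f s := by
    have h1 : ∫ x in (0 : ℝ)..1, f x =
        ∫ x in (0 : ℝ)..1, (p * κ x + ∫ s in (0 : ℝ)..1, κ (x + s) * f s) :=
      intervalIntegral.integral_congr fun x hx => heq x (by simpa using hx)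
    rw [h1, intervalIntegral.integral_add, intervalIntegral.integral_const_mul,
      intervalIntegral_intervalIntegral_swap]
    · congr 1
      · simp only [hK, add_zero]
        rw [intervalIntegral.integral_ofReal]
      · refine intervalIntegral.integral_congr fun s _ => ?_
        simp only [hK]
        rw [intervalIntegral.integral_mul_const, intervalIntegral.integral_ofReal]
    · apply ContinuousOn.integrableOn_compact (isCompact_uIcc.prod isCompact_uIcc) ?_ |>.mono_set
      · exact Set.prod_mono Set.uIoc_subset_uIcc Set.uIoc_subset_uIcc
      · exact Continuous.continuousOn (by fun_prop)
    · exact Continuous.intervalIntegrable (by fun_prop) _ _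
    · apply Continuous.intervalIntegrable
      apply intervalIntegral.continuous_parametric_intervalIntegral_of_continuous' (by fun_prop)
  have hnorm : ∫ x in (0 : ℝ)..1, ‖f x‖ ≤ ‖p‖ * K 0 + ∫ s in (0 : ℝ)..1, K s * ‖f s‖ := by
    have h1 : ∫ x in (0 : ℝ)..1, ‖f x‖ ≤
        ∫ x in (0 : ℝ)..1, (‖p‖ * κ x + ∫ s in (0 : ℝ)..1, κ (x + s) * ‖f s‖) := by
      apply intervalIntegral.integral_mono_on zero_le_one
      · exact Continuous.intervalIntegrable (by fun_prop) _ _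
      · apply Continuous.intervalIntegrable
        apply Continuous.add (by fun_prop)
        apply intervalIntegral.continuous_parametric_intervalIntegral_of_continuous' (by fun_prop)
      · intro x hx
        rw [heq x hx]
        refine (norm_add_le _ _).trans (add_le_add ?_ ?_)
        · rw [norm_mul, Complex.norm_real, Real.norm_of_nonneg (hκ0 x)]
        · refine (intervalIntegral.norm_integral_le_integral_norm zero_le_one).trans (le_of_eq ?_)
          refine intervalIntegral.integral_congr fun s _ => ?_
          rw [norm_mul, Complex.norm_real, Real.norm_of_nonneg (hκ0 _)]
    refine h1.trans (le_of_eq ?_)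
    rw [intervalIntegral.integral_add, intervalIntegral.integral_const_mul,
      intervalIntegral_intervalIntegral_swap]
    · congr 1
      · simp [hK]
      · refine intervalIntegral.integral_congr fun s _ => ?_
        simp only [hK]
        rw [intervalIntegral.integral_mul_const]
    · apply ContinuousOn.integrableOn_compact (isCompact_uIcc.prod isCompact_uIcc) ?_ |>.mono_set
      · exact Set.prod_mono Set.uIoc_subset_uIcc Set.uIoc_subset_uIcc
      · exact Continuous.continuousOn (by fun_prop)
    · exact Continuous.intervalIntegrable (by fun_prop) _ _
    · apply Continuous.intervalIntegrable
      apply intervalIntegral.continuous_parametric_intervalIntegral_of_continuous' (by fun_prop)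
  have hqK : ∀ s ∈ Set.Icc (0 : ℝ) 1, 0 ≤ q - K s := fun s hs => sub_nonneg.2 (hq s hs)
  -- The mass at the origin, rewritten with the kernel `q - K ≥ 0` by means of total mass zero.
  have hp : p = p * ((q - K 0 : ℝ) : ℂ) + ∫ s in (0 : ℝ)..1, ((q - K s : ℝ) : ℂ) * f s := by
    have h2 : ∫ s in (0 : ℝ)..1, ((q - K s : ℝ) : ℂ) * f s =
        q * (∫ s in (0 : ℝ)..1, f s) - ∫ s in (0 : ℝ)..1, K s * f s := by
      rw [← intervalIntegral.integral_const_mul, ← intervalIntegral.integral_sub]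
      · refine intervalIntegral.integral_congr fun s _ => ?_
        push_cast
        ring
      · exact Continuous.intervalIntegrable (by fun_prop) _ _
      · exact Continuous.intervalIntegrable (by fun_prop) _ _
    rw [h2]
    push_cast
    linear_combination (1 - q : ℂ) * hm - hf'
  have hpn : ‖p‖ ≤ ‖p‖ * (q - K 0) + ∫ s in (0 : ℝ)..1, (q - K s) * ‖f s‖ := by
    calc ‖p‖ = ‖p * ((q - K 0 : ℝ) : ℂ) + ∫ s in (0 : ℝ)..1, ((q - K s : ℝ) : ℂ) * f s‖ :=
          congrArg _ hp
      _ ≤ _ := by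
        refine (norm_add_le _ _).trans (add_le_add ?_ ?_)
        · rw [norm_mul, Complex.norm_real, Real.norm_of_nonneg (hqK 0 (by simp))]
        · refine (intervalIntegral.norm_integral_le_integral_norm zero_le_one).trans (le_of_eq ?_)
          refine intervalIntegral.integral_congr fun s hs => ?_
          rw [norm_mul, Complex.norm_real, Real.norm_of_nonneg (hqK s (by simpa using hs))]
  have hsplit : ∫ s in (0 : ℝ)..1, (q - K s) * ‖f s‖ =
      q * (∫ s in (0 : ℝ)..1, ‖f s‖) - ∫ s in (0 : ℝ)..1, K s * ‖f s‖ := by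
    rw [← intervalIntegral.integral_const_mul, ← intervalIntegral.integral_sub]
    · exact intervalIntegral.integral_congr fun s _ => by ring
    · exact Continuous.intervalIntegrable (by fun_prop) _ _
    · exact Continuous.intervalIntegrable (by fun_prop) _ _
  have hI0 : 0 ≤ ∫ x in (0 : ℝ)..1, ‖f x‖ :=
    intervalIntegral.integral_nonneg zero_le_one fun _ _ => norm_nonneg _
  have hsum : (1 - q) * (‖p‖ + ∫ x in (0 : ℝ)..1, ‖f x‖) ≤ 0 := by
    rw [hsplit] at hpn
    linarith
  have hz : ‖p‖ + ∫ x in (0 : ℝ)..1, ‖f x‖ ≤ 0 := by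
    by_contra! h
    exact absurd hsum (not_le.2 (mul_pos (sub_pos.2 hq1) h))
  have hp0 : p = 0 := norm_le_zero_iff.1 (by linarith)
  have hf0 : ∫ x in (0 : ℝ)..1, ‖f x‖ = 0 := by
    linarith [norm_nonneg p]
  refine ⟨hp0, fun x hx => ?_⟩
  by_contra hne
  have := intervalIntegral.integral_pos zero_lt_one hf.norm.continuousOn
    (fun x _ => norm_nonneg _) ⟨x, hx, norm_pos_iff.2 hne⟩
  exact this.ne' hf0

/-! ### The polynomial distribution function -/

/-- The polynomial `∑_{i ≤ n} c_i X^i` that gives the distribution function on `[0,1]`. -/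
def distPoly (n : ℕ) (c : ℕ → ℝ) : ℝ[X] :=
  ∑ i ∈ Finset.range (n + 1), C (c i) * X ^ i

theorem eval_distPoly (n : ℕ) (c : ℕ → ℝ) (x : ℝ) :
    (distPoly n c).eval x = ∑ i ∈ Finset.range (n + 1), c i * x ^ i := by
  simp [distPoly, eval_finsetSum]

theorem eval_iterate_derivative_distPoly (n : ℕ) (c : ℕ → ℝ) {l : ℕ} (hl : l ≤ n) (x : ℝ) :
    (derivative^[l] (distPoly n c)).eval x = ∑ i ∈ Finset.range (n - l + 1),
      c (i + l) * (((i + l).factorial : ℝ) / (i.factorial : ℝ)) * x ^ i := by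
  have h : derivative^[l] (distPoly n c) = ∑ i ∈ Finset.range (n + 1),
      C (c i) * (C ((Nat.descFactorial i l : ℕ) : ℝ) * X ^ (i - l)) := by
    rw [distPoly, iterate_derivative_sum]
    exact Finset.sum_congr rfl fun i _ => by
      rw [iterate_derivative_C_mul, iterate_derivative_X_pow_eq_C_mul]
  rw [h, eval_finsetSum, show n + 1 = l + (n - l + 1) by omega, Finset.sum_range_add]
  rw [Finset.sum_eq_zero, zero_add]
  · refine Finset.sum_congr rfl fun i _ => ?_
    have h2 : ((i + l).descFactorial l : ℝ) = ((i + l).factorial : ℝ) / (i.factorial : ℝ) := by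
      rw [eq_div_iff (by positivity), mul_comm]
      have := Nat.factorial_mul_descFactorial (Nat.le_add_right l i)
      rw [Nat.add_sub_cancel_left, add_comm l i] at this
      exact_mod_cast this
    simp [h2, add_comm l i, mul_assoc]
  · intro i hi
    rw [Nat.descFactorial_of_lt (Finset.mem_range.1 hi)]
    simp

theorem iterate_derivative_distPoly_eq_zero (n : ℕ) (c : ℕ → ℝ) :
    derivative^[n + 1] (distPoly n c) = 0 := by
  apply iterate_derivative_eq_zero
  apply Nat.lt_succ_of_le
  apply natDegree_sum_le_of_forall_le
  intro i hi
  exact (natDegree_C_mul_X_pow_le _ _).trans (Nat.lt_succ_iff.1 (Finset.mem_range.1 hi))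

/-- The coefficients `ν_k` are `μ` times the derivatives of the distribution polynomial at `1`. -/
theorem nu_eq (n : ℕ) (c : ℕ → ℝ) (μ : ℝ) {k : ℕ} (hk : k ≤ n) :
    nu n c μ k = μ * (derivative^[n - k] (distPoly n c)).eval 1 := by
  rw [nu, eval_iterate_derivative_distPoly n c (Nat.sub_le n k), Nat.sub_sub_self hk]
  congr 1
  exact Finset.sum_congr rfl fun i _ => by ring

/-! ### The transition kernel

From a waiting time `s ∈ [0,1]` the next waiting time has density `x ↦ κ (x + s)` on `(0,1]`,
where `κ` depends only on `μ` and the distribution polynomial. -/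

/-- The density at `t ∈ [0,1]` of `B - A`; on `[0,1]` the law of `B` has the derivative of the
distribution polynomial as its density. -/
def gapDensity (n : ℕ) (c : ℕ → ℝ) (μ t : ℝ) : ℝ :=
  μ * ∫ a in (0 : ℝ)..(1 - t), (derivative (distPoly n c)).eval (t + a) * Real.exp (-μ * a)

/-- The probability of `B - A > t`, for `t ∈ [0,1]`. -/
def gapTail (n : ℕ) (c : ℕ → ℝ) (μ t : ℝ) : ℝ :=
  μ * ∫ a in (0 : ℝ)..(1 - t), (1 - (distPoly n c).eval (t + a)) * Real.exp (-μ * a)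

/-- The density of `B - A` on `[0,∞)`, as a continuous function on the line: `gapDensity` with its
argument projected to `[0,1]`. It vanishes from `1` on. -/
def gapKernel (n : ℕ) (c : ℕ → ℝ) (μ t : ℝ) : ℝ :=
  gapDensity n c μ (max 0 (min t 1))

section

variable {n : ℕ} {c : ℕ → ℝ} {μ : ℝ}

theorem gapDensity_one : gapDensity n c μ 1 = 0 := by simp [gapDensity]

theorem gapTail_one : gapTail n c μ 1 = 0 := by simp [gapTail]

theorem hasDerivAt_exp_neg_mul (μ x : ℝ) :
    HasDerivAt (fun a => Real.exp (-μ * a)) (-μ * Real.exp (-μ * x)) x := by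
  simpa [mul_comm] using ((hasDerivAt_id x).const_mul (-μ)).exp

theorem hasDerivAt_gapDensity (t : ℝ) : HasDerivAt (gapDensity n c μ)
    (μ * gapDensity n c μ t - μ * (derivative (distPoly n c)).eval t) t := by
  have h := (hasDerivAt_integral_shift_mul_of_continuous (𝕜 := ℝ)
    (P := fun x => (derivative (distPoly n c)).eval x) (by fun_prop) (hasDerivAt_exp_neg_mul μ)
    (fun u v => by rw [← Real.exp_add]; ring_nf) t).const_mul μ
  refine h.congr_deriv ?_
  simp only [gapDensity, mul_zero, Real.exp_zero]
  ring

theorem continuous_gapDensity : Continuous (gapDensity n c μ) :=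
  continuous_iff_continuousAt.2 fun t => (hasDerivAt_gapDensity t).continuousAt

theorem hasDerivAt_gapTail (h1 : (distPoly n c).eval 1 = 1) (t : ℝ) :
    HasDerivAt (gapTail n c μ) (-gapDensity n c μ t) t := by
  have h := (hasDerivAt_integral_shift_mul (𝕜 := ℝ)
    (P := fun x => 1 - (distPoly n c).eval x)
    (P' := fun x => -(derivative (distPoly n c)).eval x)
    (fun x => by simpa using ((distPoly n c).hasDerivAt x).const_sub 1)
    (by fun_prop) (hasDerivAt_exp_neg_mul μ)
    (fun u v => by rw [← Real.exp_add]; ring_nf) t).const_mul μ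
  refine h.congr_deriv ?_
  simp [gapDensity, h1]

theorem continuous_gapKernel : Continuous (gapKernel n c μ) :=
  continuous_gapDensity.comp (by fun_prop)

theorem gapKernel_of_mem {t : ℝ} (ht : t ∈ Set.Icc (0 : ℝ) 1) :
    gapKernel n c μ t = gapDensity n c μ t := by
  rw [gapKernel, min_eq_left ht.2, max_eq_right ht.1]

theorem gapKernel_of_one_le {t : ℝ} (ht : 1 ≤ t) : gapKernel n c μ t = 0 := by
  rw [gapKernel, min_eq_right ht, max_eq_right zero_le_one, gapDensity_one]

theorem integral_gapKernel_add (h1 : (distPoly n c).eval 1 = 1) {x s : ℝ} (hx : 0 ≤ x)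
    (hs : 0 ≤ s) : ∫ y in x..1, gapKernel n c μ (y + s) = gapTail n c μ (min (x + s) 1) := by
  have hcut : ∀ a b : ℝ, 1 ≤ a → 1 ≤ b → ∫ y in a..b, gapKernel n c μ y = 0 := fun a b ha hb => by
    rw [intervalIntegral.integral_congr (g := fun _ => 0), intervalIntegral.integral_zero]
    intro y hy
    exact gapKernel_of_one_le ((le_min ha hb).trans hy.1)
  rw [intervalIntegral.integral_comp_add_right]
  rcases le_total (x + s) 1 with h | h
  · rw [min_eq_left h, ← intervalIntegral.integral_add_adjacent_intervals (b := 1)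
      (continuous_gapKernel.intervalIntegrable _ _) (continuous_gapKernel.intervalIntegrable _ _),
      hcut 1 (1 + s) le_rfl (by linarith), add_zero]
    rw [intervalIntegral.integral_congr (g := gapDensity n c μ)]
    · rw [intervalIntegral.integral_eq_sub_of_hasDerivAt (f := fun t => -gapTail n c μ t)
        (fun t _ => by simpa using (hasDerivAt_gapTail h1 t).fun_neg)
        (continuous_gapDensity.intervalIntegrable _ _), gapTail_one]
      ring
    · intro y hy
      rw [Set.uIcc_of_le h] at hy
      exact gapKernel_of_mem ⟨by linarith [hy.1], hy.2⟩
  · rw [min_eq_right h, gapTail_one, hcut _ _ h (by linarith)]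

namespace IsPolynomialDistribution

variable {β : Measure ℝ} (hβ : IsPolynomialDistribution n c β)
include hβ

theorem eval_one : (distPoly n c).eval 1 = 1 := by
  rw [eval_distPoly]
  simpa using hβ.sum_coeff

theorem cdf_eq {x : ℝ} (hx : x ∈ Set.Icc (0 : ℝ) 1) : cdf β x = (distPoly n c).eval x := by
  rw [hβ.cdf_of_mem x hx, eval_distPoly]

theorem derivative_nonneg {x : ℝ} (hx : x ∈ Set.Icc (0 : ℝ) 1) :
    0 ≤ (derivative (distPoly n c)).eval x := by
  have hmono : MonotoneOn (fun x => (distPoly n c).eval x) (Set.Icc (0 : ℝ) 1) := by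
    intro a ha b hb hab
    simp only [← hβ.cdf_eq ha, ← hβ.cdf_eq hb]
    exact monotone_cdf β hab
  have h : derivWithin (fun x => (distPoly n c).eval x) (Set.Icc (0 : ℝ) 1) x =
      (derivative (distPoly n c)).eval x :=
    ((distPoly n c).hasDerivAt x).hasDerivWithinAt.derivWithin
      (uniqueDiffOn_Icc zero_lt_one x hx)
  rw [← h]
  exact hmono.derivWithin_nonneg

theorem gapKernel_nonneg (hμ : 0 < μ) (t : ℝ) : 0 ≤ gapKernel n c μ t := by
  refine mul_nonneg hμ.le (intervalIntegral.integral_nonneg ?_ fun a ha => ?_)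
  · linarith [max_le zero_le_one (min_le_right t 1)]
  · refine mul_nonneg (hβ.derivative_nonneg ⟨?_, ?_⟩) (Real.exp_pos _).le
    · linarith [ha.1, le_max_left 0 (min t 1)]
    · linarith [ha.2]

theorem gapTail_le (hμ : 0 < μ) {t : ℝ} (ht : t ∈ Set.Icc (0 : ℝ) 1) :
    gapTail n c μ t ≤ 1 - Real.exp (-μ) := by
  have h1 : ∫ a in (0 : ℝ)..(1 - t), (1 - (distPoly n c).eval (t + a)) * Real.exp (-μ * a) ≤
      ∫ a in (0 : ℝ)..(1 - t), Real.exp (-μ * a) := by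
    apply intervalIntegral.integral_mono_on (by linarith [ht.2])
      (Continuous.intervalIntegrable (by fun_prop) _ _)
      (Continuous.intervalIntegrable (by fun_prop) _ _)
    intro a ha
    have : 0 ≤ (distPoly n c).eval (t + a) := by
      rw [← hβ.cdf_eq ⟨by linarith [ht.1, ha.1], by linarith [ha.2]⟩]
      exact cdf_nonneg β _
    nlinarith [Real.exp_pos (-μ * a)]
  have h2 : μ * ∫ a in (0 : ℝ)..(1 - t), Real.exp (-μ * a) = 1 - Real.exp (-μ * (1 - t)) := by
    rw [← intervalIntegral.integral_const_mul,
      intervalIntegral.integral_eq_sub_of_hasDerivAt (f := fun a => -Real.exp (-μ * a))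
      (fun a _ => by simpa using (hasDerivAt_exp_neg_mul μ a).fun_neg)
      (Continuous.intervalIntegrable (by fun_prop) _ _)]
    simp
    ring
  have h3 : Real.exp (-μ) ≤ Real.exp (-μ * (1 - t)) :=
    Real.exp_le_exp.2 (by nlinarith [ht.1])
  calc gapTail n c μ t ≤ μ * ∫ a in (0 : ℝ)..(1 - t), Real.exp (-μ * a) :=
        mul_le_mul_of_nonneg_left h1 hμ.le
    _ ≤ _ := by rw [h2]; linarith

theorem integral_gapKernel_le (hμ : 0 < μ) {s : ℝ} (hs : s ∈ Set.Icc (0 : ℝ) 1) :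
    ∫ x in (0 : ℝ)..1, gapKernel n c μ (x + s) ≤ 1 - Real.exp (-μ) := by
  rw [integral_gapKernel_add hβ.eval_one le_rfl hs.1, zero_add, min_eq_left hs.2]
  exact hβ.gapTail_le hμ hs

/-- `eq_zero_of_integral_equation` for the transition kernel of the waiting time. -/
theorem eq_zero_of_gapKernel_equation (hμ : 0 < μ) {f : ℝ → ℂ} (hf : Continuous f) {p : ℂ}
    (heq : ∀ x ∈ Set.Icc (0 : ℝ) 1,
      f x = p * gapKernel n c μ x + ∫ s in (0 : ℝ)..1, gapKernel n c μ (x + s) * f s)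
    (hm : p + ∫ x in (0 : ℝ)..1, f x = 0) :
    p = 0 ∧ ∀ x ∈ Set.Icc (0 : ℝ) 1, f x = 0 :=
  eq_zero_of_integral_equation continuous_gapKernel (hβ.gapKernel_nonneg hμ)
    (by linarith [Real.exp_pos (-μ)] : 1 - Real.exp (-μ) < 1)
    (fun _ hs => hβ.integral_gapKernel_le hμ hs) hf heq hm

end IsPolynomialDistribution

end

/-! ### Existence of a steady state -/

/-- The waiting time after the next service as a function of `((A, B), W)`. -/
def lindleyMap (p : (ℝ × ℝ) × ℝ) : ℝ := max 0 (p.1.2 - p.1.1 - p.2)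

theorem measurable_lindleyMap : Measurable lindleyMap := by
  unfold lindleyMap; fun_prop

theorem lindleyMap_preimage_Iio_zero : lindleyMap ⁻¹' Set.Iio 0 = ∅ :=
  Set.eq_empty_of_forall_notMem fun _ hp =>
    not_le.2 (show lindleyMap _ < 0 from hp) (le_max_left _ _)

theorem IsPolynomialDistribution.measure_Ioi {n : ℕ} {c : ℕ → ℝ} {β : Measure ℝ}
    (hβ : IsPolynomialDistribution n c β) {x : ℝ} (hx : 0 ≤ x) :
    β (Set.Ioi x) = ENNReal.ofReal (1 - (distPoly n c).eval (min x 1)) := by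
  have := hβ.isProbabilityMeasure
  have h : cdf β x = (distPoly n c).eval (min x 1) := by
    rcases le_total x 1 with h | h
    · rw [min_eq_left h, hβ.cdf_eq ⟨hx, h⟩]
    · rw [min_eq_right h, hβ.eval_one, hβ.cdf_of_ge x h]
  rw [← Set.compl_Iic, prob_compl_eq_one_sub measurableSet_Iic, ← ofReal_cdf, ← h,
    ENNReal.ofReal_sub _ (cdf_nonneg β x), ENNReal.ofReal_one]

/-- A steady state exists as soon as the law `α` of the first variable charges `[1, ∞)`: given
`A ≥ 1` the next waiting time is `0`. If `Q` is the transition restricted to `A < 1` and `e` the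
mass of `[1, ∞)`, then `∑ e • Q ^ k δ₀` is invariant. -/
theorem exists_invariant {α β : Measure ℝ} [IsProbabilityMeasure α] [IsProbabilityMeasure β]
    (hα : α (Set.Ici 1) ≠ 0) (hβ : β (Set.Ioi 1) = 0) :
    ∃ w : Measure ℝ, IsProbabilityMeasure w ∧ Measure.map lindleyMap ((α.prod β).prod w) = w := by
  set e := α (Set.Ici 1) with he
  have he1 : e ≤ 1 := prob_le_one
  have hc : α (Set.Iio 1) = 1 - e := by
    rw [he, ← prob_compl_eq_one_sub measurableSet_Ici, Set.compl_Ici]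
  set Q : Measure ℝ → Measure ℝ := fun m =>
    Measure.map lindleyMap (((α.restrict (Set.Iio 1)).prod β).prod m) with hQ
  have hQuniv : ∀ m : Measure ℝ, [SFinite m] → Q m Set.univ = (1 - e) * m Set.univ := by
    intro m _
    rw [hQ, Measure.map_apply measurable_lindleyMap MeasurableSet.univ, Set.preimage_univ,
      ← Set.univ_prod_univ, Measure.prod_prod, ← Set.univ_prod_univ, Measure.prod_prod]
    simp [hc]
  have hQneg : ∀ m : Measure ℝ, Q m (Set.Iio 0) = 0 := by
    intro m
    rw [hQ, Measure.map_apply measurable_lindleyMap measurableSet_Iio, lindleyMap_preimage_Iio_zero,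
      measure_empty]
  have hQs : ∀ m : Measure ℝ, [SFinite m] → SFinite (Q m) := fun m _ => by
    rw [hQ]; infer_instance
  have hstep : ∀ m : Measure ℝ, [SFinite m] → m (Set.Iio 0) = 0 →
      Measure.map lindleyMap ((α.prod β).prod m) = Q m + (e * m Set.univ) • Measure.dirac 0 := by
    intro m _ hm
    have h0 : ∀ᵐ p ∂(((α.restrict (Set.Ici 1)).prod β).prod m), lindleyMap p = 0 := by
      have ha : ∀ᵐ p ∂(((α.restrict (Set.Ici 1)).prod β).prod m), p.1.1 ∈ Set.Ici (1 : ℝ) :=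
        Measure.quasiMeasurePreserving_fst.ae (Measure.quasiMeasurePreserving_fst.ae
          (ae_restrict_mem measurableSet_Ici))
      have hb : ∀ᵐ p ∂(((α.restrict (Set.Ici 1)).prod β).prod m), p.1.2 ≤ (1 : ℝ) := by
        refine Measure.quasiMeasurePreserving_fst.ae
          (p := fun p : ℝ × ℝ => p.2 ≤ 1) 
          (Measure.quasiMeasurePreserving_snd.ae (p := fun y : ℝ => y ≤ 1) ?_)
        rw [ae_iff]
        simpa [Set.Ioi] using hβ
      have hw : ∀ᵐ p ∂(((α.restrict (Set.Ici 1)).prod β).prod m), (0 : ℝ) ≤ p.2 := by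
        refine Measure.quasiMeasurePreserving_snd.ae ?_
        rw [ae_iff]
        simpa [Set.Iio] using hm
      filter_upwards [ha, hb, hw] with p h1 h2 h3
      exact max_eq_left (by linarith [Set.mem_Ici.1 h1])
    have hsplit : α = α.restrict (Set.Iio 1) + α.restrict (Set.Ici 1) := by
      rw [← Set.compl_Iio, Measure.restrict_add_restrict_compl measurableSet_Iio]
    conv_lhs => rw [hsplit]
    rw [Measure.add_prod, Measure.add_prod, Measure.map_add _ _ measurable_lindleyMap,
      Measure.map_congr (g := fun _ => (0 : ℝ)) h0, Measure.map_const, ← Set.univ_prod_univ,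
      Measure.prod_prod, ← Set.univ_prod_univ, Measure.prod_prod]
    simp [he, hQ]
  set v : ℕ → Measure ℝ := fun k => Q^[k] (Measure.dirac 0) with hv
  have hvs : ∀ k, SFinite (v k) := by
    intro k
    induction k with
    | zero => simp only [hv, Function.iterate_zero, id]; infer_instance
    | succ k ih => simp only [hv, Function.iterate_succ_apply'] at ih ⊢; exact hQs _
  have hvuniv : ∀ k, v k Set.univ = (1 - e) ^ k := by
    intro k
    induction k with
    | zero => simp [hv]
    | succ k ih =>
      have := hvs k
      rw [show v (k + 1) = Q (v k) from Function.iterate_succ_apply' _ _ _, hQuniv, ih, pow_succ']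
  have hvneg : ∀ k, v k (Set.Iio 0) = 0 := by
    intro k
    cases k with
    | zero => simp [hv]
    | succ k => rw [show v (k + 1) = Q (v k) from Function.iterate_succ_apply' _ _ _, hQneg]
  set w : Measure ℝ := Measure.sum fun k => e • v k with hw
  have hes : ∀ k, SFinite (e • v k) := fun k => by
    have := hvs k
    infer_instance
  have hws : SFinite w := by rw [hw]; infer_instance
  have hw1 : w Set.univ = 1 := by
    rw [hw, Measure.sum_apply _ MeasurableSet.univ]
    simp only [Measure.smul_apply, hvuniv, smul_eq_mul]
    rw [ENNReal.tsum_mul_left, ENNReal.tsum_geometric,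
      ENNReal.sub_sub_cancel ENNReal.one_ne_top he1,
      ENNReal.mul_inv_cancel hα (ne_top_of_le_ne_top ENNReal.one_ne_top he1)]
  have hwneg : w (Set.Iio 0) = 0 := by
    rw [hw, Measure.sum_apply _ measurableSet_Iio]
    simp [hvneg]
  have hQw : Q w = Measure.sum fun k => e • v (k + 1) := by
    have : ∀ k, v (k + 1) = Q (v k) := fun k => Function.iterate_succ_apply' _ _ _
    simp only [this]
    simp only [hQ, hw]
    rw [Measure.prod_sum_right, Measure.map_sum measurable_lindleyMap.aemeasurable]
    congr 1
    funext k
    have := hvs k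
    rw [Measure.prod_smul_right, Measure.map_smul]
  refine ⟨w, ⟨hw1⟩, ?_⟩
  rw [hstep w hwneg, hw1, mul_one, hQw]
  ext s hs
  rw [hw, Measure.add_apply, Measure.sum_apply _ hs, Measure.sum_apply _ hs,
    tsum_eq_zero_add' (f := fun k => (e • v k) s) ENNReal.summable, add_comm]
  rfl

theorem IsPolynomialDistribution.exists_isSteadyState {n : ℕ} {c : ℕ → ℝ} {β : Measure ℝ} {μ : ℝ}
    (hβ : IsPolynomialDistribution n c β) (hμ : 0 < μ) : ∃ w, IsSteadyState μ β w := by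
  have := hβ.isProbabilityMeasure
  have := isProbabilityMeasure_expMeasure hμ
  have hα : (expMeasure μ) (Set.Ici 1) ≠ 0 := by
    intro h0
    have h1 : (expMeasure μ) (Set.Iic 1) = 1 := by
      rw [← prob_compl_eq_zero_iff measurableSet_Iic, Set.compl_Iic]
      exact measure_mono_null Set.Ioi_subset_Ici_self h0
    rw [← ofReal_cdf, cdf_expMeasure_eq hμ] at h1
    simp only [zero_le_one, if_true, mul_one, ENNReal.ofReal_eq_one] at h1
    linarith [Real.exp_pos (-μ)]
  have hβ1 : β (Set.Ioi 1) = 0 := by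
    rw [hβ.measure_Ioi zero_le_one, min_self, hβ.eval_one]
    simp
  obtain ⟨w, hw, h⟩ := exists_invariant hα hβ1
  exact ⟨w, hw, h⟩

/-! ### The atom and the density of a steady state -/

/-- The probability of `B > A + t`, by conditioning on `A`: only the distribution function of `B`
enters, not its atom and density. -/
theorem IsPolynomialDistribution.lintegral_measure_Ioi {n : ℕ} {c : ℕ → ℝ} {β : Measure ℝ} {μ : ℝ}
    (hβ : IsPolynomialDistribution n c β) (hμ : 0 < μ) {t : ℝ} (ht : 0 ≤ t) :
    ∫⁻ a, β (Set.Ioi (a + t)) ∂(expMeasure μ) = ENNReal.ofReal (gapTail n c μ (min t 1)) := by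
  have hm : Measurable fun a => β (Set.Ioi (a + t)) :=
    (Antitone.measurable fun a b hab => measure_mono (Set.Ioi_subset_Ioi (by linarith)))
  have hd : ∀ a, exponentialPDF μ a * β (Set.Ioi (a + t)) =
      (Set.Icc 0 (1 - min t 1)).indicator (fun a => ENNReal.ofReal
        (μ * ((1 - (distPoly n c).eval (min t 1 + a)) * Real.exp (-μ * a)))) a := by
    intro a
    by_cases ha : a ∈ Set.Icc 0 (1 - min t 1)
    · rw [Set.indicator_of_mem ha, exponentialPDF_of_nonneg ha.1,
        hβ.measure_Ioi (add_nonneg ha.1 ht), ← ENNReal.ofReal_mul (by positivity)]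
      have : min (a + t) 1 = min t 1 + a := by
        rcases le_total t 1 with h | h
        · rw [min_eq_left h] at ha ⊢
          rw [min_eq_left (by linarith [ha.2]), add_comm]
        · rw [min_eq_right h] at ha ⊢
          have : a = 0 := le_antisymm (by linarith [ha.2]) ha.1
          rw [this, zero_add, add_zero, min_eq_right h]
      rw [this]
      ring_nf
    · rw [Set.indicator_of_notMem ha]
      by_cases h0 : 0 ≤ a
      · have h1 : 1 - min t 1 < a := not_le.1 fun h => ha ⟨h0, h⟩
        have h2 : 1 ≤ a + t := by linarith [min_le_left t 1]
        rw [hβ.measure_Ioi (by linarith), min_eq_right h2, hβ.eval_one]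
        simp
      · rw [exponentialPDF_of_neg (not_le.1 h0), zero_mul]
  have hnn : ∀ a ∈ Set.Icc 0 (1 - min t 1),
      0 ≤ μ * ((1 - (distPoly n c).eval (min t 1 + a)) * Real.exp (-μ * a)) := by
    intro a ha
    have hmem : min t 1 + a ∈ Set.Icc (0 : ℝ) 1 :=
      ⟨add_nonneg (le_min ht zero_le_one) ha.1, by linarith [ha.2]⟩
    have := hβ.cdf_eq hmem ▸ cdf_le_one β (min t 1 + a)
    have := sub_nonneg.2 this
    positivity
  calc ∫⁻ a, β (Set.Ioi (a + t)) ∂(expMeasure μ)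
      = ∫⁻ a, exponentialPDF μ a * β (Set.Ioi (a + t)) := by
        rw [show expMeasure μ = volume.withDensity (exponentialPDF μ) from rfl,
          lintegral_withDensity_eq_lintegral_mul _
            (f := exponentialPDF μ) (measurable_exponentialPDFReal μ).ennreal_ofReal hm]
        rfl
    _ = ∫⁻ a in Set.Icc 0 (1 - min t 1), ENNReal.ofReal
        (μ * ((1 - (distPoly n c).eval (min t 1 + a)) * Real.exp (-μ * a))) := by
        rw [← lintegral_indicator measurableSet_Icc]
        exact lintegral_congr hd
    _ = _ := by
        rw [← ofReal_integral_eq_lintegral_ofReal, integral_Icc_eq_integral_Ioc,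
          ← intervalIntegral.integral_of_le (by linarith [min_le_right t 1]),
          intervalIntegral.integral_const_mul, gapTail]
        · exact (Continuous.continuousOn (by fun_prop)).integrableOn_compact isCompact_Icc
        · exact (ae_restrict_iff' measurableSet_Icc).2 (Filter.Eventually.of_forall hnn)

/-- The density on `[0,1]` of the waiting time that follows a waiting time of law `w`. -/
def stepDensity (n : ℕ) (c : ℕ → ℝ) (μ : ℝ) (w : Measure ℝ) (x : ℝ) : ℝ :=
  ∫ s, gapKernel n c μ (x + s) ∂w

theorem exists_gapKernel_bound (n : ℕ) (c : ℕ → ℝ) (μ : ℝ) :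
    ∃ M, ∀ t, ‖gapKernel n c μ t‖ ≤ M := by
  obtain ⟨M, hM⟩ := (isCompact_Icc (a := (0 : ℝ)) (b := 1)).exists_bound_of_continuousOn
    (continuous_gapDensity (n := n) (c := c) (μ := μ)).continuousOn
  exact ⟨M, fun t => hM _ ⟨le_max_left _ _, max_le zero_le_one (min_le_right _ _)⟩⟩

theorem integrable_gapKernel (n : ℕ) (c : ℕ → ℝ) (μ : ℝ) (w : Measure ℝ) [IsFiniteMeasure w]
    (x : ℝ) : Integrable (fun s => gapKernel n c μ (x + s)) w := by
  obtain ⟨M, hM⟩ := exists_gapKernel_bound n c μ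
  exact Integrable.of_bound (continuous_gapKernel.comp (by fun_prop)).aestronglyMeasurable M
    (Filter.Eventually.of_forall fun s => hM _)

theorem continuous_stepDensity (n : ℕ) (c : ℕ → ℝ) (μ : ℝ) (w : Measure ℝ) [IsFiniteMeasure w] :
    Continuous (stepDensity n c μ w) := by
  obtain ⟨M, hM⟩ := exists_gapKernel_bound n c μ
  refine continuous_of_dominated (bound := fun _ => M) (fun x => ?_)
    (fun x => Filter.Eventually.of_forall fun s => hM _) (integrable_const M)
    (Filter.Eventually.of_forall fun s => continuous_gapKernel.comp (by fun_prop))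
  exact (continuous_gapKernel.comp (by fun_prop)).aestronglyMeasurable

namespace IsSteadyState

variable {n : ℕ} {c : ℕ → ℝ} {μ : ℝ} {β w : Measure ℝ} (hw : IsSteadyState μ β w)
include hw

theorem measure_Iio_zero : w (Set.Iio 0) = 0 := by
  rw [← hw.map_eq]
  change Measure.map lindleyMap _ _ = 0
  rw [Measure.map_apply measurable_lindleyMap measurableSet_Iio, lindleyMap_preimage_Iio_zero,
    measure_empty]

theorem ae_nonneg : ∀ᵐ s ∂w, 0 ≤ s := by
  rw [ae_iff]
  simpa [Set.Iio] using hw.measure_Iio_zero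

theorem measure_Ioi (hβ : IsPolynomialDistribution n c β) (hμ : 0 < μ) {x : ℝ} (hx : 0 ≤ x) :
    w (Set.Ioi x) = ∫⁻ s, ENNReal.ofReal (gapTail n c μ (min (x + s) 1)) ∂w := by
  have := hβ.isProbabilityMeasure
  have := hw.isProbabilityMeasure
  have := isProbabilityMeasure_expMeasure hμ
  have hpre := measurable_lindleyMap (measurableSet_Ioi (a := x))
  conv_lhs => rw [← hw.map_eq]
  change Measure.map lindleyMap _ _ = _
  rw [Measure.map_apply measurable_lindleyMap measurableSet_Ioi, Measure.prod_apply_symm hpre]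
  refine lintegral_congr_ae ?_
  filter_upwards [hw.ae_nonneg] with s hs
  rw [Measure.prod_apply (hpre.preimage measurable_prodMk_right),
    ← hβ.lintegral_measure_Ioi hμ (add_nonneg hx hs)]
  refine lintegral_congr fun a => congrArg β ?_
  ext b
  simp only [Set.mem_preimage, lindleyMap, Set.mem_Ioi, lt_max_iff, not_lt.2 hx, false_or]
  constructor <;> intro h <;> linarith

theorem lintegral_stepDensity (hβ : IsPolynomialDistribution n c β) (hμ : 0 < μ) {x : ℝ}
    (hx : 0 ≤ x) : ∫⁻ y in Set.Ioc x 1, ENNReal.ofReal (stepDensity n c μ w y) =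
      w (Set.Ioi x) := by
  have := hw.isProbabilityMeasure
  have hκ := hβ.gapKernel_nonneg hμ
  have cκ := continuous_gapKernel (n := n) (c := c) (μ := μ)
  rw [hw.measure_Ioi hβ hμ hx]
  rcases le_total x 1 with hx1 | hx1
  · have h1 : ∀ y, ENNReal.ofReal (stepDensity n c μ w y) =
        ∫⁻ s, ENNReal.ofReal (gapKernel n c μ (y + s)) ∂w := fun y =>
      ofReal_integral_eq_lintegral_ofReal (integrable_gapKernel n c μ w y)
        (Filter.Eventually.of_forall fun s => hκ _)
    simp only [h1]
    rw [lintegral_lintegral_swap]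
    · refine lintegral_congr_ae ?_
      filter_upwards [hw.ae_nonneg] with s hs
      rw [← integral_gapKernel_add hβ.eval_one hx hs, intervalIntegral.integral_of_le hx1,
        ofReal_integral_eq_lintegral_ofReal]
      · have cs : Continuous fun y => gapKernel n c μ (y + s) := by fun_prop
        exact (cs.continuousOn.integrableOn_compact isCompact_Icc).mono_set Set.Ioc_subset_Icc_self
      · exact Filter.Eventually.of_forall fun y => hκ _
    · exact (ENNReal.measurable_ofReal.comp
        (cκ.measurable.comp (measurable_fst.add measurable_snd))).aemeasurable
  · rw [Set.Ioc_eq_empty (not_lt.2 hx1), Measure.restrict_empty, lintegral_zero_measure]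
    symm
    rw [lintegral_eq_zero_of_ae_eq_zero]
    filter_upwards [hw.ae_nonneg] with s hs
    rw [min_eq_right (by linarith), gapTail_one]
    simp

theorem measure_Ioi_zero_lt (hβ : IsPolynomialDistribution n c β) (hμ : 0 < μ) :
    w (Set.Ioi 0) < 1 := by
  have := hw.isProbabilityMeasure
  rw [hw.measure_Ioi hβ hμ le_rfl]
  calc ∫⁻ s, ENNReal.ofReal (gapTail n c μ (min (0 + s) 1)) ∂w
      ≤ ∫⁻ _, ENNReal.ofReal (1 - Real.exp (-μ)) ∂w := by
        refine lintegral_mono_ae ?_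
        filter_upwards [hw.ae_nonneg] with s hs
        refine ENNReal.ofReal_le_ofReal (hβ.gapTail_le hμ ⟨?_, min_le_right _ _⟩)
        exact le_min (by linarith) zero_le_one
    _ < 1 := by
        rw [lintegral_const, measure_univ, mul_one, ENNReal.ofReal_lt_one]
        linarith [Real.exp_pos (-μ)]

theorem measure_zero_add : w {0} + w (Set.Ioi 0) = 1 := by
  have := hw.isProbabilityMeasure
  have hIci : w (Set.Ici 0) = 1 := by
    rw [← prob_compl_eq_zero_iff measurableSet_Ici, Set.compl_Ici]
    exact hw.measure_Iio_zero
  rw [← measure_union (by simp) measurableSet_Ioi, Set.singleton_union, Set.Ioi_insert, hIci]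

theorem real_zero_pos (hβ : IsPolynomialDistribution n c β) (hμ : 0 < μ) : 0 < w.real {0} := by
  have := hw.isProbabilityMeasure
  refine ENNReal.toReal_pos (fun h => ?_) (measure_ne_top _ _)
  have h1 := hw.measure_zero_add
  rw [h, zero_add] at h1
  exact (hw.measure_Ioi_zero_lt hβ hμ).ne h1

theorem eq_dirac_add_withDensity (hβ : IsPolynomialDistribution n c β) (hμ : 0 < μ) :
    w = ENNReal.ofReal (w.real {0}) • Measure.dirac 0 +
      (volume.restrict (Set.Icc (0 : ℝ) 1)).withDensity
        (fun x => ENNReal.ofReal (stepDensity n c μ w x)) := by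
  have := hw.isProbabilityMeasure
  set w' := ENNReal.ofReal (w.real {0}) • Measure.dirac 0 +
      (volume.restrict (Set.Icc (0 : ℝ) 1)).withDensity
        (fun x => ENNReal.ofReal (stepDensity n c μ w x)) with hw'
  have h0 : ENNReal.ofReal (w.real {0}) = w {0} := ofReal_measureReal
  have hIoi : ∀ x : ℝ, 0 ≤ x → w' (Set.Ioi x) = w (Set.Ioi x) := by
    intro x hx
    rw [hw', Measure.add_apply, withDensity_apply _ measurableSet_Ioi,
      Measure.restrict_restrict measurableSet_Ioi, Measure.smul_apply,
      Measure.dirac_apply' _ measurableSet_Ioi, ← hw.lintegral_stepDensity hβ hμ hx]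
    have hset : Set.Ioi x ∩ Set.Icc 0 1 = Set.Ioc x 1 := by
      ext y
      simp only [Set.mem_inter_iff, Set.mem_Ioi, Set.mem_Icc, Set.mem_Ioc]
      exact ⟨fun h => ⟨h.1, h.2.2⟩, fun h => ⟨h.1, by linarith [h.1], h.2⟩⟩
    rw [hset, Set.indicator_of_notMem (by simpa using hx)]
    simp
  have hneg : w' (Set.Iio 0) = 0 := by
    rw [hw', Measure.add_apply, withDensity_apply _ measurableSet_Iio,
      Measure.restrict_restrict measurableSet_Iio, Measure.smul_apply,
      Measure.dirac_apply' _ measurableSet_Iio]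
    have hset : Set.Iio (0 : ℝ) ∩ Set.Icc 0 1 = ∅ := by
      ext y
      simp only [Set.mem_inter_iff, Set.mem_Iio, Set.mem_Icc, Set.mem_empty_iff_false, iff_false]
      exact fun h => absurd h.1 (not_lt.2 h.2.1)
    rw [hset]
    simp
  have hzero : w' {0} = w {0} := by
    rw [hw', Measure.add_apply, Measure.smul_apply, withDensity_apply _ (measurableSet_singleton _),
      h0]
    have : (volume.restrict (Set.Icc (0 : ℝ) 1)) {0} = 0 := measure_singleton _
    rw [Measure.restrict_eq_zero.2 this]
    simp
  have huniv : IsProbabilityMeasure w' := by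
    constructor
    have hset : (Set.univ : Set ℝ) = Set.Iio 0 ∪ ({0} ∪ Set.Ioi 0) := by
      ext y
      simp
    rw [hset, measure_union ?_ (by measurability), measure_union (by simp) measurableSet_Ioi, hneg,
      hzero, hIoi 0 le_rfl, zero_add, hw.measure_zero_add]
    rw [Set.disjoint_left]
    intro y hy
    simpa using hy
  refine Measure.ext_of_Iic w w' fun x => ?_
  rcases lt_or_ge x 0 with hx | hx
  · rw [measure_mono_null (Set.Iic_subset_Iio.2 hx) hneg,
      measure_mono_null (Set.Iic_subset_Iio.2 hx) hw.measure_Iio_zero]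
  · rw [← Set.compl_Ioi, prob_compl_eq_one_sub measurableSet_Ioi,
      prob_compl_eq_one_sub measurableSet_Ioi, hIoi x hx]

theorem stepDensity_nonneg (hβ : IsPolynomialDistribution n c β) (hμ : 0 < μ) (x : ℝ) :
    0 ≤ stepDensity n c μ w x := by
  have := hw.isProbabilityMeasure
  exact integral_nonneg fun s => hβ.gapKernel_nonneg hμ _

theorem integral_eq (hβ : IsPolynomialDistribution n c β) (hμ : 0 < μ) {g : ℝ → ℝ}
    (hg : Continuous g) : ∫ s, g s ∂w =
      w.real {0} * g 0 + ∫ s in (0 : ℝ)..1, g s * stepDensity n c μ w s := by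
  have := hw.isProbabilityMeasure
  have cf := continuous_stepDensity n c μ w
  have hf0 := hw.stepDensity_nonneg hβ hμ
  have hint : Integrable (fun s => (ENNReal.ofReal (stepDensity n c μ w s)).toReal • g s)
      (volume.restrict (Set.Icc (0 : ℝ) 1)) := by
    simp only [ENNReal.toReal_ofReal (hf0 _)]
    exact (Continuous.continuousOn (by fun_prop)).integrableOn_compact isCompact_Icc
  conv_lhs => rw [hw.eq_dirac_add_withDensity hβ hμ]
  rw [integral_add_measure, integral_smul_measure, integral_dirac,
    integral_withDensity_eq_integral_toReal_smul cf.measurable.ennreal_ofReal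
      (Filter.Eventually.of_forall fun _ => ENNReal.ofReal_lt_top),
    integral_Icc_eq_integral_Ioc, ← intervalIntegral.integral_of_le zero_le_one]
  · simp only [ENNReal.toReal_ofReal (hf0 _), ENNReal.toReal_ofReal measureReal_nonneg, smul_eq_mul,
      mul_comm]
  · exact (integrable_dirac (by simp)).smul_measure ENNReal.ofReal_ne_top
  · rwa [integrable_withDensity_iff_integrable_smul' cf.measurable.ennreal_ofReal
      (Filter.Eventually.of_forall fun _ => ENNReal.ofReal_lt_top)]

theorem stepDensity_eq (hβ : IsPolynomialDistribution n c β) (hμ : 0 < μ) (x : ℝ) :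
    stepDensity n c μ w x = w.real {0} * gapKernel n c μ x +
      ∫ s in (0 : ℝ)..1, gapKernel n c μ (x + s) * stepDensity n c μ w s := by
  have h := hw.integral_eq hβ hμ (g := fun s => gapKernel n c μ (x + s))
    (continuous_gapKernel.comp (by fun_prop))
  simpa [stepDensity] using h

theorem real_zero_add_integral (hβ : IsPolynomialDistribution n c β) (hμ : 0 < μ) :
    w.real {0} + ∫ s in (0 : ℝ)..1, stepDensity n c μ w s = 1 := by
  have := hw.isProbabilityMeasure
  have h := hw.integral_eq hβ hμ (g := fun _ => (1 : ℝ)) continuous_const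
  simpa using h.symm

end IsSteadyState

section

variable {n : ℕ} {c : ℕ → ℝ} {μ : ℝ} {r ζ d D : Fin (2 * n + 2) → ℂ} {p : ℂ}

/-! ### Exponential sums

The coefficients `d i` enter only through the products `D i = d i * ζ i`, so that exponential sums
are written as `expSum r 1 D`. -/

theorem hasDerivAt_expSum (l : ℕ) (x : ℝ) :
    HasDerivAt (expSum r ζ d l) (expSum r ζ d (l + 1) x) x := by
  unfold expSum
  refine HasDerivAt.fun_sum fun i _ => ?_
  have h : HasDerivAt (fun x : ℝ => Complex.exp (r i * x)) (r i * Complex.exp (r i * x)) x := by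
    simpa [mul_comm] using ((Complex.ofRealCLM.hasDerivAt (x := x)).const_mul (r i)).cexp
  exact (h.const_mul (d i * ζ i * r i ^ l)).congr_deriv (by ring)

theorem continuous_expSum (l : ℕ) : Continuous (expSum r ζ d l) :=
  continuous_iff_continuousAt.2 fun x => (hasDerivAt_expSum l x).continuousAt

theorem expSum_eq_one (l : ℕ) (x : ℝ) : expSum r ζ d l x = expSum r 1 (d * ζ) l x := by
  simp [expSum]

theorem integral_mul_expSum {P : ℝ → ℂ} (hP : Continuous P) (a b : ℝ) :
    ∫ s in a..b, P s * expSum r 1 D 0 s =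
      ∑ i, D i * ∫ s in a..b, P s * Complex.exp (r i * s) := by
  simp only [expSum, Finset.mul_sum]
  rw [intervalIntegral.integral_finsetSum]
  · refine Finset.sum_congr rfl fun i _ => ?_
    rw [← intervalIntegral.integral_const_mul]
    congr 1
    funext s
    simp
    ring
  · exact fun i _ => Continuous.intervalIntegrable (by fun_prop) _ _

theorem hasDerivAt_integral_shift_mul_expSum {P P' : ℝ → ℂ} (hP : ∀ x, HasDerivAt P (P' x) x)
    (hP' : Continuous P') (y : ℝ) :
    HasDerivAt (fun y : ℝ => ∫ s in (0 : ℝ)..(1 - y), P (y + s) * expSum r 1 D 0 s)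
      ((∫ s in (0 : ℝ)..(1 - y), P' (y + s) * expSum r 1 D 0 s) -
        P 1 * expSum r 1 D 0 (1 - y)) y := by
  have cP : Continuous P := continuous_iff_continuousAt.2 fun x => (hP x).continuousAt
  have h1 : ∀ y : ℝ, ∫ s in (0 : ℝ)..(1 - y), P (y + s) * expSum r 1 D 0 s =
      ∑ i, D i * ∫ s in (0 : ℝ)..(1 - y), P (y + s) * Complex.exp (r i * s) := fun y =>
    integral_mul_expSum (P := fun s => P (y + s)) (by fun_prop) _ _
  rw [funext h1, integral_mul_expSum (P := fun s => P' (y + s)) (by fun_prop)]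
  refine (HasDerivAt.fun_sum fun i _ => (hasDerivAt_integral_shift_mul hP hP'
    (f := fun s : ℝ => Complex.exp (r i * s)) (r := r i) (fun x => ?_) (fun u v => ?_)
    y).const_mul (D i)).congr_deriv ?_
  · simpa [mul_comm] using ((Complex.ofRealCLM.hasDerivAt (x := x)).const_mul (r i)).cexp
  · rw [← Complex.exp_add]
    push_cast
    ring_nf
  · simp only [expSum, mul_sub, Finset.sum_sub_distrib, Finset.mul_sum]
    congr 1
    refine Finset.sum_congr rfl fun i _ => ?_
    simp
    ring

theorem hasDerivAt_eval_ofReal (P : ℝ[X]) (x : ℝ) :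
    HasDerivAt (fun x : ℝ => ((P.eval x : ℝ) : ℂ)) (((derivative P).eval x : ℝ) : ℂ) x :=
  (P.hasDerivAt x).ofReal_comp

/-- The truncated correlation `y ↦ ∫ s in 0..1-y, P (y + s) * f s` of a polynomial with an
exponential sum. -/
def polyCorr (r D : Fin (2 * n + 2) → ℂ) (P : ℝ[X]) (y : ℝ) : ℂ :=
  ∫ s in (0 : ℝ)..(1 - y), ((P.eval (y + s) : ℝ) : ℂ) * expSum r 1 D 0 s

theorem hasDerivAt_polyCorr (P : ℝ[X]) (y : ℝ) : HasDerivAt (polyCorr r D P)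
    (polyCorr r D (derivative P) y - (P.eval 1 : ℝ) * expSum r 1 D 0 (1 - y)) y :=
  hasDerivAt_integral_shift_mul_expSum (hasDerivAt_eval_ofReal P) (by fun_prop) y

/-- Distinct exponentials are linearly independent on `[0,1]`: differentiate at an interior point
and use that the Vandermonde matrix is invertible. -/
theorem eq_zero_of_expSum_eq_zero (hr : Function.Injective r)
    (h : ∀ x ∈ Set.Icc (0 : ℝ) 1, expSum r 1 D 0 x = 0) : D = 0 := by
  have hl : ∀ l : ℕ, ∀ x ∈ Set.Ioo (0 : ℝ) 1, expSum r 1 D l x = 0 := by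
    intro l
    induction l with
    | zero => exact fun x hx => h x (Set.Ioo_subset_Icc_self hx)
    | succ l ih =>
      intro x hx
      refine (hasDerivAt_expSum l x).unique
        ((hasDerivAt_const x (0 : ℂ)).congr_of_eventuallyEq ?_)
      filter_upwards [isOpen_Ioo.mem_nhds hx] with y hy using ih y hy
  have hv := Matrix.eq_zero_of_forall_pow_sum_mul_pow_eq_zero hr
    (v := fun i => D i * Complex.exp (r i * (1 / 2 : ℝ))) fun l => by
      rw [← hl l (1 / 2) (by norm_num)]
      refine Finset.sum_congr rfl fun i _ => ?_
      simp
      ring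
  funext i
  have := congrFun hv i
  simpa [Complex.exp_ne_zero] using this

/-! ### Solutions of the linear system solve the integral equation -/

/-- The differences of the two sides of the initial conditions, with the sums over moments written
as integrals against derivatives of the distribution polynomial. Position `0` stands
for the condition on `f 0`, position `m + 1` for the one on the derivative of order `m + 1`. -/
def initialDefect (n : ℕ) (c : ℕ → ℝ) (μ : ℝ) (r D : Fin (2 * n + 2) → ℂ) (p : ℂ) : ℕ → ℂ
  | 0 => expSum r 1 D 0 0 - μ * p + μ * p * ((distPoly n c).eval 0 : ℝ) +
      μ * polyCorr r D (distPoly n c) 0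
  | m + 1 => expSum r 1 D (m + 1) 0 - μ * expSum r 1 D m 0 +
      μ * p * ((derivative^[m + 1] (distPoly n c)).eval 0 : ℝ) +
      μ * (-1) ^ m * expSum r 1 D m 1 +
      μ * polyCorr r D (derivative^[m + 1] (distPoly n c)) 0 -
      ∑ j ∈ Finset.range (m + 1), (nu n c μ (n - j) : ℂ) * (-1) ^ (m - j) * expSum r 1 D (m - j) 1

/-- The defect of the `m`-th derivative of the integro-differential equation
`f' = μ f - μ (p F' + ∫ s in 0..1-x, F' (x + s) * f s)` of an exponential sum `f`, where `F` is the
distribution polynomial. The term `μ (-1) ^ m f⁽ᵐ⁾(1 - x)` cancels the summand `j = 0` when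
`F 1 = 1`; it is kept to match the shape of the initial conditions. -/
def odeDefect (n : ℕ) (c : ℕ → ℝ) (μ : ℝ) (r D : Fin (2 * n + 2) → ℂ) (p : ℂ) (m : ℕ)
    (x : ℝ) : ℂ :=
  expSum r 1 D (m + 1) x - μ * expSum r 1 D m x +
      μ * p * ((derivative^[m + 1] (distPoly n c)).eval x : ℝ) +
      μ * (-1) ^ m * expSum r 1 D m (1 - x) +
      μ * polyCorr r D (derivative^[m + 1] (distPoly n c)) x -
      ∑ j ∈ Finset.range (m + 1), μ * ((derivative^[j] (distPoly n c)).eval 1 : ℝ) *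
        (-1) ^ (m - j) * expSum r 1 D (m - j) (1 - x)

theorem hasDerivAt_expSum_one_sub (l : ℕ) (x : ℝ) :
    HasDerivAt (fun x => expSum r ζ d l (1 - x)) (-expSum r ζ d (l + 1) (1 - x)) x := by
  simpa [Function.comp_def] using
    (hasDerivAt_expSum (r := r) (ζ := ζ) (d := d) l (1 - x)).scomp x
      ((hasDerivAt_id x).const_sub 1)

theorem hasDerivAt_odeDefect (m : ℕ) (x : ℝ) :
    HasDerivAt (odeDefect n c μ r D p m) (odeDefect n c μ r D p (m + 1) x) x := by
  have h1 := hasDerivAt_expSum (r := r) (ζ := 1) (d := D) (m + 1) x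
  have h2 := (hasDerivAt_expSum (r := r) (ζ := 1) (d := D) m x).const_mul (μ : ℂ)
  have h3 := (hasDerivAt_eval_ofReal (derivative^[m + 1] (distPoly n c)) x).const_mul (μ * p)
  have h4 := (hasDerivAt_expSum_one_sub (r := r) (ζ := 1) (d := D) m x).const_mul
    ((μ : ℂ) * (-1) ^ m)
  have h5 := (hasDerivAt_polyCorr (r := r) (D := D) (derivative^[m + 1] (distPoly n c))
    x).const_mul (μ : ℂ)
  have h6 := HasDerivAt.fun_sum (u := Finset.range (m + 1)) fun j _ =>
    (hasDerivAt_expSum_one_sub (r := r) (ζ := 1) (d := D) (m - j) x).const_mul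
      ((μ : ℂ) * ((derivative^[j] (distPoly n c)).eval 1 : ℝ) * (-1) ^ (m - j))
  refine (((((h1.sub h2).add h3).add h4).add h5).sub h6).congr_deriv ?_
  have h7 : ∀ j ∈ Finset.range (m + 1),
      (μ : ℂ) * ((derivative^[j] (distPoly n c)).eval 1 : ℝ) * (-1) ^ (m - j) *
        -expSum r 1 D (m - j + 1) (1 - x) =
      (μ : ℂ) * ((derivative^[j] (distPoly n c)).eval 1 : ℝ) * (-1) ^ (m + 1 - j) *
        expSum r 1 D (m + 1 - j) (1 - x) := by
    intro j hj
    have : m + 1 - j = m - j + 1 := by have := Finset.mem_range.1 hj; omega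
    rw [this]
    ring
  rw [Finset.sum_congr rfl h7, odeDefect, Finset.sum_range_succ _ (m + 1), Nat.sub_self,
    Function.iterate_succ_apply' _ (m + 1)]
  ring

/-- The highest defect vanishes identically by the relations between opposite coefficients. -/
theorem odeDefect_eq_zero_of_relation (h1 : (distPoly n c).eval 1 = 1)
    (hrev : ∀ i, r i.rev = -r i)
    (hrel : ∀ i, D i * r i ^ n * (r i - μ) =
      Complex.exp (-r i) * D i.rev * ∑ j ∈ Finset.range n, (nu n c μ j : ℂ) * r i ^ j) (x : ℝ) :
    odeDefect n c μ r D p n x = 0 := by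
  have hR : expSum r 1 D (n + 1) x - μ * expSum r 1 D n x =
      ∑ j ∈ Finset.range n, (nu n c μ j : ℂ) * (-1) ^ j * expSum r 1 D j (1 - x) := by
    have hL : expSum r 1 D (n + 1) x - μ * expSum r 1 D n x =
        ∑ i, Complex.exp (-r i) * D i.rev * (∑ j ∈ Finset.range n, (nu n c μ j : ℂ) * r i ^ j) *
          Complex.exp (r i * x) := by
      simp only [expSum, Finset.mul_sum (s := Finset.univ), ← Finset.sum_sub_distrib]
      refine Finset.sum_congr rfl fun i _ => ?_
      rw [← hrel i]
      simp
      ring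
    rw [hL, ← Equiv.sum_comp Fin.revPerm]
    simp only [Fin.revPerm_apply, Fin.rev_rev, hrev, neg_neg, expSum, Finset.mul_sum,
      Finset.sum_mul]
    rw [Finset.sum_comm]
    refine Finset.sum_congr rfl fun j _ => Finset.sum_congr rfl fun i _ => ?_
    rw [show r i * ((1 - x : ℝ) : ℂ) = r i + -r i * x by push_cast; ring, Complex.exp_add,
      neg_pow (r i)]
    simp
    ring
  have hS : ∑ j ∈ Finset.range (n + 1), (μ : ℂ) * ((derivative^[j] (distPoly n c)).eval 1 : ℝ) *
        (-1) ^ (n - j) * expSum r 1 D (n - j) (1 - x) =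
      ∑ j ∈ Finset.range n, (nu n c μ j : ℂ) * (-1) ^ j * expSum r 1 D j (1 - x) +
        μ * (-1) ^ n * expSum r 1 D n (1 - x) := by
    rw [← Finset.sum_range_reflect, Finset.sum_range_succ]
    congr 1
    · refine Finset.sum_congr rfl fun j hj => ?_
      have hj := Finset.mem_range.1 hj
      rw [nu_eq n c μ hj.le, show n + 1 - 1 - j = n - j by omega, Nat.sub_sub_self hj.le]
      push_cast
      ring
    · simp [h1]
  rw [odeDefect, hS, iterate_derivative_distPoly_eq_zero]
  simp only [polyCorr, eval_zero, Complex.ofReal_zero, zero_mul, intervalIntegral.integral_zero,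
    mul_zero, add_zero]
  linear_combination hR

theorem eq_zero_of_hasDerivAt_zero {g : ℝ → ℂ} (hg : ∀ x, HasDerivAt g 0 x) {a : ℝ}
    (ha : g a = 0) (x : ℝ) : g x = 0 := by
  rw [← ha]
  exact is_const_of_deriv_eq_zero (fun y => (hg y).differentiableAt) (fun y => (hg y).deriv) x a

theorem odeDefect_eq_zero (h1 : (distPoly n c).eval 1 = 1)
    (hrev : ∀ i, r i.rev = -r i)
    (hrel : ∀ i, D i * r i ^ n * (r i - μ) =
      Complex.exp (-r i) * D i.rev * ∑ j ∈ Finset.range n, (nu n c μ j : ℂ) * r i ^ j)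
    (hinit : ∀ m < n, initialDefect n c μ r D p (m + 1) = 0) {m : ℕ} (hm : m ≤ n) (x : ℝ) :
    odeDefect n c μ r D p m x = 0 := by
  induction hm using Nat.decreasingInduction generalizing x with
  | self => exact odeDefect_eq_zero_of_relation h1 hrev hrel x
  | of_succ m hm ih =>
    refine eq_zero_of_hasDerivAt_zero (a := 0)
      (fun y => (hasDerivAt_odeDefect m y).congr_deriv (ih y)) ?_ x
    rw [← hinit m hm, odeDefect, initialDefect]
    congr 1
    · simp
    · refine Finset.sum_congr rfl fun j hj => ?_
      have hj := Finset.mem_range.1 hj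
      rw [nu_eq n c μ (Nat.sub_le n j), Nat.sub_sub_self (by omega)]
      simp

theorem polyCorr_neg (P : ℝ[X]) (x : ℝ) : polyCorr r D (-P) x = -polyCorr r D P x := by
  simp [polyCorr]

theorem polyCorr_one_sub_zero (P : ℝ[X]) :
    polyCorr r D (1 - P) 0 = (∫ s in (0 : ℝ)..1, expSum r 1 D 0 s) - polyCorr r D P 0 := by
  have cE := continuous_expSum (r := r) (ζ := 1) (d := D) 0
  have cP : Continuous fun s => ((P.eval s : ℝ) : ℂ) := by fun_prop
  simp only [polyCorr, zero_add, sub_zero, eval_sub, eval_one, Complex.ofReal_sub, sub_mul,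
    Complex.ofReal_one, one_mul]
  rw [intervalIntegral.integral_sub (cE.intervalIntegrable _ _)
    (Continuous.intervalIntegrable (by fun_prop) _ _)]

/-- A solution of the relations and the initial conditions vanishes at `1`. -/
theorem expSum_one_eq_zero (h1 : (distPoly n c).eval 1 = 1)
    (hode : ∀ x, odeDefect n c μ r D p 0 x = 0) (hinit : initialDefect n c μ r D p 0 = 0) :
    expSum r 1 D 0 1 = 0 := by
  have cE := continuous_expSum (r := r) (ζ := 1) (d := D) 0
  -- An antiderivative of the equation: `U' = 0`, `U 0 = 0` by the condition on `f 0`, `U 1 = f 1`.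
  set U : ℝ → ℂ := fun x => expSum r 1 D 0 x + μ * (∫ t in x..1, expSum r 1 D 0 t) -
    μ * (p * ((1 - distPoly n c).eval x : ℝ) + polyCorr r D (1 - distPoly n c) x) with hU
  have hd : ∀ x, HasDerivAt U 0 x := by
    intro x
    have hI : HasDerivAt (fun x : ℝ => ∫ t in x..1, expSum r 1 D 0 t) (-expSum r 1 D 0 x) x :=
      intervalIntegral.integral_hasDerivAt_left (cE.intervalIntegrable _ _)
        (cE.stronglyMeasurableAtFilter _ _) cE.continuousAt
    have h := ((hasDerivAt_expSum (r := r) (ζ := 1) (d := D) 0 x).add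
      (hI.const_mul (μ : ℂ))).sub
      ((((hasDerivAt_eval_ofReal (1 - distPoly n c) x).const_mul p).add
        (hasDerivAt_polyCorr (r := r) (D := D) (1 - distPoly n c) x)).const_mul (μ : ℂ))
    refine h.congr_deriv ?_
    have h0 := hode x
    simp only [odeDefect, zero_add, Function.iterate_one, pow_zero, mul_one, Finset.sum_range_one,
      Function.iterate_zero, id, Nat.sub_zero, h1, Complex.ofReal_one] at h0
    rw [derivative_sub, derivative_one, zero_sub, polyCorr_neg]
    simp only [eval_neg, eval_sub, eval_one, h1, zero_add, Complex.ofReal_neg, sub_self,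
      Complex.ofReal_zero, zero_mul]
    linear_combination h0
  have h0 : U 0 = 0 := by
    simp only [hU, polyCorr_one_sub_zero, eval_sub, eval_one, Complex.ofReal_sub,
      Complex.ofReal_one]
    simp only [initialDefect] at hinit
    linear_combination hinit
  have := eq_zero_of_hasDerivAt_zero hd h0 1
  simpa [hU, polyCorr, h1] using this

/-- An exponential sum with mass `p` at the origin that satisfies the relations and the initial
conditions is fixed by the transition of the waiting time: both sides satisfy the same first-order
equation and vanish at `1`. -/
theorem gapKernel_equation (h1 : (distPoly n c).eval 1 = 1)
    (hrev : ∀ i, r i.rev = -r i)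
    (hrel : ∀ i, D i * r i ^ n * (r i - μ) =
      Complex.exp (-r i) * D i.rev * ∑ j ∈ Finset.range n, (nu n c μ j : ℂ) * r i ^ j)
    (hinit : ∀ l ≤ n, initialDefect n c μ r D p l = 0) {x : ℝ} (hx : x ∈ Set.Icc (0 : ℝ) 1) :
    expSum r 1 D 0 x = p * gapKernel n c μ x +
      ∫ s in (0 : ℝ)..1, gapKernel n c μ (x + s) * expSum r 1 D 0 s := by
  have cE := continuous_expSum (r := r) (ζ := 1) (d := D) 0
  have cg := continuous_gapDensity (n := n) (c := c) (μ := μ)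
  have hode : ∀ x, odeDefect n c μ r D p 0 x = 0 := odeDefect_eq_zero h1 hrev hrel
    (fun m hm => hinit (m + 1) hm) (Nat.zero_le n)
  set b : ℝ[X] := derivative (distPoly n c) with hb
  have hg : ∀ x, HasDerivAt (fun x => (gapDensity n c μ x : ℂ))
      (μ * gapDensity n c μ x - μ * (b.eval x : ℝ)) x := fun x => by
    simpa using (hasDerivAt_gapDensity (n := n) (c := c) (μ := μ) x).ofReal_comp
  set G : ℝ → ℂ := fun x => ∫ s in (0 : ℝ)..(1 - x), (gapDensity n c μ (x + s) : ℂ) *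
    expSum r 1 D 0 s with hG
  have hGd : ∀ x, HasDerivAt G (μ * G x - μ * polyCorr r D b x) x := by
    intro x
    refine (hasDerivAt_integral_shift_mul_expSum hg (by fun_prop) x).congr_deriv ?_
    rw [gapDensity_one, Complex.ofReal_zero, zero_mul, sub_zero, hG, polyCorr]
    simp only
    rw [← intervalIntegral.integral_const_mul, ← intervalIntegral.integral_const_mul,
      ← intervalIntegral.integral_sub]
    · congr 1
      funext s
      ring
    · exact Continuous.intervalIntegrable (by fun_prop) _ _
    · exact Continuous.intervalIntegrable (by fun_prop) _ _
  have hV : ∀ x, HasDerivAt (fun x : ℝ => Complex.exp (-μ * x) *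
      (expSum r 1 D 0 x - (p * gapDensity n c μ x + G x))) 0 x := by
    intro x
    have he : HasDerivAt (fun x : ℝ => Complex.exp (-μ * x)) (-μ * Complex.exp (-μ * x)) x := by
      simpa [mul_comm] using ((Complex.ofRealCLM.hasDerivAt (x := x)).const_mul (-μ : ℂ)).cexp
    refine (he.mul ((hasDerivAt_expSum 0 x).sub (((hg x).const_mul p).add
      (hGd x)))).congr_deriv ?_
    have h0 := hode x
    simp only [odeDefect, zero_add, Function.iterate_one, pow_zero, mul_one, Finset.sum_range_one,
      Function.iterate_zero, id, Nat.sub_zero, h1, Complex.ofReal_one, ← hb] at h0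
    simp only [zero_add, Pi.sub_apply, Pi.add_apply]
    linear_combination Complex.exp (-μ * x) * h0
  have hV0 := eq_zero_of_hasDerivAt_zero hV (a := 1) (by
    rw [expSum_one_eq_zero h1 hode (hinit 0 (Nat.zero_le n)), gapDensity_one]
    simp [hG]) x
  have hE : expSum r 1 D 0 x = p * gapDensity n c μ x + G x := by
    simpa [Complex.exp_ne_zero, sub_eq_zero] using hV0
  rw [hE, gapKernel_of_mem hx]
  congr 1
  have cκ := continuous_gapKernel (n := n) (c := c) (μ := μ)
  have hint : Continuous fun s => (gapKernel n c μ (x + s) : ℂ) * expSum r 1 D 0 s := by fun_prop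
  rw [← intervalIntegral.integral_add_adjacent_intervals (hint.intervalIntegrable 0 (1 - x))
    (hint.intervalIntegrable (1 - x) 1)]
  have h2 : ∫ s in (1 - x)..1, (gapKernel n c μ (x + s) : ℂ) * expSum r 1 D 0 s = 0 := by
    rw [intervalIntegral.integral_congr (g := fun _ => 0), intervalIntegral.integral_zero]
    intro s hs
    rw [Set.uIcc_of_le (by linarith [hx.1])] at hs
    simp only
    rw [gapKernel_of_one_le (by linarith [hs.1]), Complex.ofReal_zero, zero_mul]
  rw [h2, add_zero]
  refine intervalIntegral.integral_congr fun s hs => ?_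
  rw [Set.uIcc_of_le (by linarith [hx.2])] at hs
  rw [gapKernel_of_mem ⟨by linarith [hx.1, hs.1], by linarith [hs.2]⟩]

end

section

variable {n : ℕ} {c : ℕ → ℝ} {μ : ℝ} {r ζ θ d D D' : Fin (2 * n + 2) → ℂ} {p p' : ℂ}

/-! ### The linear system in the products of the coefficients -/

theorem sum_moments_eq_polyCorr {l : ℕ} (hl : l ≤ n) :
    ∑ i ∈ Finset.range (n - l + 1),
        (c (i + l) : ℂ) * (((i + l).factorial : ℂ) / (i.factorial : ℂ)) *
          ∫ y in (0 : ℝ)..1, (y : ℂ) ^ i * expSum r 1 D 0 y =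
      polyCorr r D (derivative^[l] (distPoly n c)) 0 := by
  have cE := continuous_expSum (r := r) (ζ := 1) (d := D) 0
  simp only [polyCorr, eval_iterate_derivative_distPoly n c hl, zero_add, sub_zero]
  push_cast
  simp only [Finset.sum_mul]
  rw [intervalIntegral.integral_finsetSum]
  · refine Finset.sum_congr rfl fun i _ => ?_
    rw [← intervalIntegral.integral_const_mul]
    congr 1
    funext y
    ring
  · exact fun i _ => Continuous.intervalIntegrable (by fun_prop) _ _

theorem eval_zero_iterate_derivative_distPoly {l : ℕ} (hl : l ≤ n) :
    (derivative^[l] (distPoly n c)).eval 0 = l.factorial * c l := by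
  rw [eval_iterate_derivative_distPoly n c hl, Finset.sum_range_succ']
  simp [mul_comm]

theorem solvesLinearSystem_iff : SolvesLinearSystem n c μ r ζ d p ↔
    (∀ i, (d * ζ) i * r i ^ n * (r i - μ) = Complex.exp (-r i) * (d * ζ) i.rev *
      ∑ j ∈ Finset.range n, (nu n c μ j : ℂ) * r i ^ j) ∧
    (∀ l ≤ n, initialDefect n c μ r (d * ζ) p l = 0) ∧
    p + ∫ x in (0 : ℝ)..1, expSum r 1 (d * ζ) 0 x = 1 := by
  have hzero : (expSum r ζ d 0 0 = μ * p - μ * p * c 0 - μ * ∑ i ∈ Finset.range (n + 1),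
      (c i : ℂ) * ∫ y in (0 : ℝ)..1, (y : ℂ) ^ i * expSum r ζ d 0 y) ↔
      initialDefect n c μ r (d * ζ) p 0 = 0 := by
    have h1 : ∑ i ∈ Finset.range (n + 1),
        (c i : ℂ) * ∫ y in (0 : ℝ)..1, (y : ℂ) ^ i * expSum r ζ d 0 y =
        polyCorr r (d * ζ) (distPoly n c) 0 := by
      have := sum_moments_eq_polyCorr (c := c) (r := r) (D := d * ζ) (Nat.zero_le n)
      rw [Function.iterate_zero, id] at this
      rw [← this]
      refine Finset.sum_congr rfl fun i _ => ?_
      have : (i.factorial : ℂ) ≠ 0 := by exact_mod_cast i.factorial_ne_zero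
      simp [expSum_eq_one (r := r) (ζ := ζ), this]
    have h2 : (distPoly n c).eval 0 = c 0 := by
      simpa using eval_zero_iterate_derivative_distPoly (n := n) (c := c) (Nat.zero_le n)
    rw [h1, initialDefect, h2, expSum_eq_one]
    constructor <;> intro h <;> linear_combination h
  have hsucc : ∀ m < n, (expSum r ζ d (m + 1) 0 =
      (μ * expSum r ζ d (m + 1 - 1) 0 - μ * p * (((m + 1).factorial : ℂ) * c (m + 1)) -
        μ * (-1) ^ (m + 1 - 1) * expSum r ζ d (m + 1 - 1) 1 -
        μ * ∑ i ∈ Finset.range (n - (m + 1) + 1),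
          (c (i + (m + 1)) : ℂ) * (((i + (m + 1)).factorial : ℂ) / (i.factorial : ℂ)) *
            ∫ y in (0 : ℝ)..1, (y : ℂ) ^ i * expSum r ζ d 0 y) +
      ∑ j ∈ Finset.range (m + 1), (nu n c μ (n - j) : ℂ) * (-1) ^ (m + 1 - 1 - j) *
        expSum r ζ d (m + 1 - 1 - j) 1) ↔ initialDefect n c μ r (d * ζ) p (m + 1) = 0 := by
    intro m hm
    simp only [expSum_eq_one (r := r) (ζ := ζ), Nat.add_sub_cancel]
    rw [sum_moments_eq_polyCorr hm, initialDefect, eval_zero_iterate_derivative_distPoly hm]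
    push_cast
    constructor <;> intro h <;> linear_combination h
  constructor
  · intro h
    refine ⟨fun i => ?_, fun l hl => ?_, ?_⟩
    · have := h.relation i
      simpa [mul_assoc] using this
    · cases l with
      | zero => exact hzero.1 h.initial_zero
      | succ m => exact (hsucc m hl).1 (h.initial (m + 1) (Finset.mem_Icc.2 ⟨by omega, hl⟩))
    · rw [h.normalisation]
      simp only [expSum_eq_one (r := r) (ζ := ζ), sub_add_cancel]
  · rintro ⟨h1, h2, h3⟩
    refine ⟨fun i => ?_, hzero.2 (h2 0 (Nat.zero_le n)), fun l hl => ?_, ?_⟩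
    · have := h1 i
      simpa [mul_assoc] using this
    · obtain ⟨hl1, hl2⟩ := Finset.mem_Icc.1 hl
      obtain ⟨m, rfl⟩ : ∃ m, l = m + 1 := ⟨l - 1, by omega⟩
      exact (hsucc m hl2).2 (h2 (m + 1) hl2)
    · simp only [expSum_eq_one (r := r) (ζ := ζ)]
      exact eq_sub_of_add_eq h3

theorem expSum_add (l : ℕ) (x : ℝ) :
    expSum r 1 (D + D') l x = expSum r 1 D l x + expSum r 1 D' l x := by
  simp [expSum, add_mul, Finset.sum_add_distrib]

theorem expSum_smul (a : ℂ) (l : ℕ) (x : ℝ) :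
    expSum r 1 (a • D) l x = a * expSum r 1 D l x := by
  simp [expSum, Finset.mul_sum, mul_assoc]

theorem polyCorr_add (P : ℝ[X]) (x : ℝ) :
    polyCorr r (D + D') P x = polyCorr r D P x + polyCorr r D' P x := by
  have hP : Continuous fun s : ℝ => ((P.eval (x + s) : ℝ) : ℂ) := by fun_prop
  simp [polyCorr, integral_mul_expSum hP, add_mul, Finset.sum_add_distrib]

theorem polyCorr_smul (a : ℂ) (P : ℝ[X]) (x : ℝ) :
    polyCorr r (a • D) P x = a * polyCorr r D P x := by
  have hP : Continuous fun s : ℝ => ((P.eval (x + s) : ℝ) : ℂ) := by fun_prop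
  simp [polyCorr, integral_mul_expSum hP, Finset.mul_sum, mul_assoc]

theorem initialDefect_add (l : ℕ) : initialDefect n c μ r (D + D') (p + p') l =
    initialDefect n c μ r D p l + initialDefect n c μ r D' p' l := by
  cases l with
  | zero =>
    simp only [initialDefect, expSum_add, polyCorr_add]
    ring
  | succ m =>
    simp only [initialDefect, expSum_add, polyCorr_add, mul_add, Finset.sum_add_distrib]
    ring

theorem initialDefect_smul (a : ℂ) (l : ℕ) : initialDefect n c μ r (a • D) (a * p) l =
    a * initialDefect n c μ r D p l := by
  cases l with
  | zero =>
    simp only [initialDefect, expSum_smul, polyCorr_smul]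
    ring
  | succ m =>
    simp only [initialDefect, expSum_smul, polyCorr_smul, mul_sub, mul_add, Finset.mul_sum]
    congr 1
    · ring
    · exact Finset.sum_congr rfl fun j _ => by ring

theorem polyCorr_one_zero : polyCorr r D 1 0 = ∫ x in (0 : ℝ)..1, expSum r 1 D 0 x := by
  simp [polyCorr]

/-- The defects of the initial conditions together with the total mass, as a linear map. -/
def systemMap (n : ℕ) (c : ℕ → ℝ) (μ : ℝ) (r : Fin (2 * n + 2) → ℂ) :
    ((Fin (2 * n + 2) → ℂ) × ℂ) →ₗ[ℂ] (Fin (n + 1) → ℂ) × ℂ where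
  toFun q := (fun l => initialDefect n c μ r q.1 q.2 l, q.2 + polyCorr r q.1 1 0)
  map_add' q q' := by
    ext l
    · exact initialDefect_add _
    · simp only [Prod.fst_add, Prod.snd_add, polyCorr_add]
      ring
  map_smul' a q := by
    ext l
    · exact initialDefect_smul a _
    · simp only [Prod.smul_fst, Prod.smul_snd, polyCorr_smul, smul_eq_mul, RingHom.id_apply]
      ring

/-- A homogeneous solution of the linear system vanishes: it gives a fixed point of total mass zero
of the transition of the waiting time. -/
theorem IsPolynomialDistribution.eq_zero_of_systemMap_eq_zero {β : Measure ℝ}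
    (hβ : IsPolynomialDistribution n c β) (hμ : 0 < μ) (hr : Function.Injective r)
    (hrev : ∀ i, r i.rev = -r i)
    (hrel : ∀ i, D i * r i ^ n * (r i - μ) =
      Complex.exp (-r i) * D i.rev * ∑ j ∈ Finset.range n, (nu n c μ j : ℂ) * r i ^ j)
    (h : systemMap n c μ r (D, p) = 0) : D = 0 ∧ p = 0 := by
  have hinit : ∀ l ≤ n, initialDefect n c μ r D p l = 0 := fun l hl =>
    congrFun (congrArg Prod.fst h) ⟨l, Nat.lt_succ_of_le hl⟩
  have hm : p + ∫ x in (0 : ℝ)..1, expSum r 1 D 0 x = 0 := by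
    rw [← polyCorr_one_zero]
    exact congrArg Prod.snd h
  obtain ⟨h1, h2⟩ := hβ.eq_zero_of_gapKernel_equation hμ (continuous_expSum 0)
    (fun x hx => gapKernel_equation hβ.eval_one hrev hrel hinit hx) hm
  exact ⟨eq_zero_of_expSum_eq_zero hr h2, h1⟩

/-! ### Roots of the characteristic polynomial -/

theorem eval_nuPoly (z : ℂ) :
    (nuPoly n c μ).eval z = ∑ i ∈ Finset.range n, (nu n c μ i : ℂ) * z ^ i := by
  simp [nuPoly, eval_finsetSum]

theorem eval_charPoly (z : ℂ) : (charPoly n c μ).eval z = z ^ (2 * n) * (z ^ 2 - μ ^ 2) +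
    (-1) ^ n * ((nuPoly n c μ).eval z * (nuPoly n c μ).eval (-z)) := by
  simp [charPoly]

theorem isRoot_neg {z : ℂ} (hz : (charPoly n c μ).IsRoot z) : (charPoly n c μ).IsRoot (-z) := by
  rw [IsRoot.def, eval_charPoly] at hz ⊢
  rw [neg_neg, (even_two_mul n).neg_pow, neg_sq, mul_comm ((nuPoly n c μ).eval (-z)), hz]

theorem natDegree_charPoly : (charPoly n c μ).natDegree = 2 * n + 2 := by
  have h1 : (X ^ (2 * n) * (X ^ 2 - C ((μ : ℂ) ^ 2))).natDegree = 2 * n + 2 := by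
    rw [natDegree_mul (pow_ne_zero _ X_ne_zero) (X_pow_sub_C_ne_zero two_pos _),
      natDegree_X_pow, natDegree_X_pow_sub_C]
  have h2 : (nuPoly n c μ).natDegree ≤ n - 1 := by
    refine natDegree_sum_le_of_forall_le _ _ fun i hi => ?_
    exact (natDegree_C_mul_X_pow_le _ _).trans (by have := Finset.mem_range.1 hi; omega)
  have h3 : ((nuPoly n c μ).comp (-X)).natDegree ≤ n - 1 := by
    refine natDegree_comp_le.trans ?_
    rwa [natDegree_neg, natDegree_X, mul_one]
  have h4 : ((-1) ^ n * (nuPoly n c μ * (nuPoly n c μ).comp (-X))).natDegree < 2 * n + 2 := by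
    have h5 : ((-1 : ℂ[X]) ^ n).natDegree = 0 := by
      rcases neg_one_pow_eq_or ℂ[X] n with h | h <;> simp [h]
    have h6 := natDegree_mul_le (p := nuPoly n c μ) (q := (nuPoly n c μ).comp (-X))
    have h7 := natDegree_mul_le (p := (-1 : ℂ[X]) ^ n)
      (q := nuPoly n c μ * (nuPoly n c μ).comp (-X))
    omega
  rw [charPoly, natDegree_add_eq_left_of_natDegree_lt (by rwa [h1]), h1]

/-- The position of the pair `{i, i.rev}` among the first `n + 1` positions. -/
def pairIndex (i : Fin (2 * n + 2)) : Fin (n + 1) := ⟨min i (2 * n + 1 - i), by omega⟩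

theorem pairIndex_rev (i : Fin (2 * n + 2)) : pairIndex i.rev = pairIndex i := by
  ext
  simp only [pairIndex, Fin.val_rev]
  omega

/-- A vector in the kernel of a singular `2 × 2` matrix. -/
theorem exists_ne_zero_of_mul_eq {A B C G : ℂ} (h : A * C = B * G) :
    ∃ u v : ℂ, (u ≠ 0 ∨ v ≠ 0) ∧ u * A = v * B ∧ v * C = u * G := by
  by_cases hAB : B ≠ 0 ∨ A ≠ 0
  · exact ⟨B, A, hAB, mul_comm _ _, h⟩
  · push Not at hAB
    obtain ⟨rfl, rfl⟩ := hAB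
    by_cases hCG : C ≠ 0 ∨ G ≠ 0
    · exact ⟨C, G, hCG, by simp, mul_comm _ _⟩
    · push Not at hCG
      obtain ⟨rfl, rfl⟩ := hCG
      exact ⟨1, 1, by simp, by simp, by simp⟩

/-- Simple roots can be labelled so that opposite positions carry opposite roots. The roots come in
pairs `{z, -z}`, and their number `2 * n + 2` is even, which excludes the root `0`. -/
theorem exists_labelling (hsimple : (charPoly n c μ).roots.Nodup) :
    ∃ r : Fin (2 * n + 2) → ℂ, Function.Injective r ∧ (∀ i, (charPoly n c μ).IsRoot (r i)) ∧
      ∀ i, r i.rev = -r i := by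
  classical
  have hne : charPoly n c μ ≠ 0 := ne_zero_of_natDegree_gt (n := 0) (by
    rw [natDegree_charPoly]; omega)
  set S : Finset ℂ := ⟨(charPoly n c μ).roots, hsimple⟩ with hS
  have hSmem : ∀ z, z ∈ S ↔ (charPoly n c μ).IsRoot z := fun z => mem_roots hne
  have hScard : S.card = 2 * n + 2 := by
    rw [← natDegree_charPoly (n := n) (c := c) (μ := μ)]
    exact IsAlgClosed.card_roots_eq_natDegree
  -- One root out of each pair of opposite ones.
  set pos : ℂ → Prop := fun z => 0 < z.re ∨ (z.re = 0 ∧ 0 < z.im) with hpos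
  have hnot : ∀ z, pos z → ¬ pos (-z) := by
    intro z hz hz'
    simp only [hpos, Complex.neg_re, Complex.neg_im] at hz hz'
    rcases hz with h | ⟨h, h'⟩ <;> rcases hz' with h2 | ⟨h2, h2'⟩ <;> linarith
  have htri : ∀ z, ¬ pos z → ¬ pos (-z) → z = 0 := by
    intro z hz hz'
    simp only [hpos, Complex.neg_re, Complex.neg_im, not_or, not_and, not_lt] at hz hz'
    have hre : z.re = 0 := le_antisymm hz.1 (by linarith [hz'.1])
    exact Complex.ext hre (le_antisymm (hz.2 hre) (by simpa using hz'.2 (by simp [hre])))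
  set H := S.filter pos with hH
  have hneg : (S.filter fun z => ¬ pos z).filter (fun z => pos (-z)) = H.image Neg.neg := by
    ext z
    simp only [hH, Finset.mem_filter, Finset.mem_image, hSmem]
    constructor
    · rintro ⟨⟨h1, h2⟩, h3⟩
      exact ⟨-z, ⟨isRoot_neg h1, h3⟩, neg_neg z⟩
    · rintro ⟨y, ⟨h1, h2⟩, rfl⟩
      exact ⟨⟨isRoot_neg h1, hnot y h2⟩, by rwa [neg_neg]⟩
  have hzero : ((S.filter fun z => ¬ pos z).filter (fun z => ¬ pos (-z))).card ≤ 1 := by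
    refine Finset.card_le_one.2 fun a ha b hb => ?_
    simp only [Finset.mem_filter] at ha hb
    rw [htri a ha.1.2 ha.2, htri b hb.1.2 hb.2]
  have hHcard : H.card = n + 1 := by
    have h1 := Finset.card_filter_add_card_filter_not (s := S) pos
    have h2 := Finset.card_filter_add_card_filter_not (s := S.filter fun z => ¬ pos z)
      (fun z => pos (-z))
    rw [hneg, Finset.card_image_of_injective _ neg_injective] at h2
    rw [hScard, ← hH] at h1
    omega
  set e := (Finset.equivFinOfCardEq hHcard).symm with he
  have hepos : ∀ k, pos (e k) := fun k => (Finset.mem_filter.1 (e k).2).2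
  have heroot : ∀ k, (charPoly n c μ).IsRoot (e k) := fun k =>
    (hSmem _).1 (Finset.mem_filter.1 (e k).2).1
  have hpair : ∀ i j : Fin (2 * n + 2), (i.val < n + 1 ↔ j.val < n + 1) →
      (e (pairIndex i) : ℂ) = e (pairIndex j) → i = j := by
    intro i j hij h
    have h1 := congrArg Fin.val (e.injective (Subtype.ext h))
    simp only [pairIndex] at h1
    ext
    omega
  refine ⟨fun i => if i.val < n + 1 then (e (pairIndex i) : ℂ) else -e (pairIndex i), ?_, ?_, ?_⟩
  · intro i j hij
    simp only at hij
    split_ifs at hij with h1 h2 h2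
    · exact hpair i j (by tauto) hij
    · exact absurd (hij ▸ hepos (pairIndex i)) (hnot _ (hepos _))
    · exact absurd (hij ▸ hepos (pairIndex j)) (hnot _ (hepos _))
    · exact hpair i j (by tauto) (neg_injective hij)
  · intro i
    simp only
    split_ifs
    · exact heroot _
    · exact isRoot_neg (heroot _)
  · intro i
    simp only [pairIndex_rev, Fin.val_rev]
    by_cases h : i.val < n + 1
    · rw [if_pos h, if_neg (by omega)]
    · rw [if_neg h, if_pos (by omega), neg_neg]

theorem exists_isCharacteristicData (hsimple : (charPoly n c μ).roots.Nodup) :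
    ∃ r ζ θ : Fin (2 * n + 2) → ℂ, IsCharacteristicData n c μ r ζ θ := by
  obtain ⟨r, hinj, hroot, hrev⟩ := exists_labelling hsimple
  have key : ∀ i, ∃ u v : ℂ, (u ≠ 0 ∨ v ≠ 0) ∧
      u * (r i ^ (n + 1) - μ * r i ^ n) = v * (nuPoly n c μ).eval (r i) ∧
      v * (r i ^ (n + 1) + μ * r i ^ n) = u * ((-1) ^ (n + 1) * (nuPoly n c μ).eval (-r i)) := by
    intro i
    refine exists_ne_zero_of_mul_eq ?_
    have h := hroot i
    rw [IsRoot.def, eval_charPoly] at h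
    linear_combination h
  choose ζ θ hne h1 h2 using key
  refine ⟨r, ζ, θ, hinj, hroot, hrev, hne, fun i => ?_, fun i => ?_⟩
  · have h := h1 i
    rw [eval_nuPoly, Finset.mul_sum] at h
    have h3 : ∑ k ∈ Finset.range n, (nu n c μ k : ℂ) * θ i * r i ^ k =
        ∑ k ∈ Finset.range n, θ i * ((nu n c μ k : ℂ) * r i ^ k) :=
      Finset.sum_congr rfl fun k _ => by ring
    rw [h3]
    linear_combination h
  · have h := h2 i
    rw [eval_nuPoly, Finset.mul_sum, Finset.mul_sum] at h
    have h3 : ∑ k ∈ Finset.range n, (nu n c μ k : ℂ) * (-1) ^ (n + 1 + k) * ζ i * r i ^ k =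
        ∑ k ∈ Finset.range n, ζ i * ((-1) ^ (n + 1) * ((nu n c μ k : ℂ) * (-r i) ^ k)) :=
      Finset.sum_congr rfl fun k _ => by rw [neg_pow (r i), pow_add]; ring
    rw [h3]
    linear_combination h

/-! ### Solvability of the linear system -/

/-- The two relations of a pair `{i, i.rev}` of opposite roots are linearly dependent, as the
characteristic polynomial is their determinant; a nontrivial solution is chosen for each pair. -/
theorem exists_relation_solution (hroot : ∀ i, (charPoly n c μ).IsRoot (r i))
    (hrev : ∀ i, r i.rev = -r i) :
    ∃ a : Fin (2 * n + 2) → ℂ, (∀ i, a i ≠ 0 ∨ a i.rev ≠ 0) ∧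
      ∀ i, a i * r i ^ n * (r i - μ) =
        Complex.exp (-r i) * a i.rev * ∑ j ∈ Finset.range n, (nu n c μ j : ℂ) * r i ^ j := by
  have key : ∀ i, ∃ u v : ℂ, (u ≠ 0 ∨ v ≠ 0) ∧
      u * (r i ^ n * (r i - μ)) = v * (Complex.exp (-r i) * (nuPoly n c μ).eval (r i)) ∧
      v * ((-r i) ^ n * (-r i - μ)) = u * (Complex.exp (r i) * (nuPoly n c μ).eval (-r i)) := by
    intro i
    refine exists_ne_zero_of_mul_eq ?_
    have h := hroot i
    rw [IsRoot.def, eval_charPoly] at h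
    have he : Complex.exp (-r i) * Complex.exp (r i) = 1 := by
      rw [← Complex.exp_add, neg_add_cancel, Complex.exp_zero]
    have hs : ((-1 : ℂ) ^ n) * (-1) ^ n = 1 := by rw [← mul_pow]; simp
    rw [neg_pow (r i)]
    linear_combination (-(-1 : ℂ) ^ n) * h +
      (nuPoly n c μ).eval (r i) * (nuPoly n c μ).eval (-r i) * (hs - he)
  choose u v hne h1 h2 using key
  refine ⟨fun i => if i.val < n + 1 then u i else v i.rev, fun i => ?_, fun i => ?_⟩
  · by_cases h : i.val < n + 1
    · have h' : ¬ (i.rev.val < n + 1) := by rw [Fin.val_rev]; omega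
      simpa only [h, h', if_true, if_false, Fin.rev_rev] using hne i
    · have h' : i.rev.val < n + 1 := by rw [Fin.val_rev]; omega
      simpa only [h, h', if_true, if_false, or_comm] using hne i.rev
  · rw [← eval_nuPoly]
    by_cases h : i.val < n + 1
    · have h' : ¬ (i.rev.val < n + 1) := by rw [Fin.val_rev]; omega
      simp only [h, h', if_true, if_false, Fin.rev_rev]
      linear_combination h1 i
    · have h' : i.rev.val < n + 1 := by rw [Fin.val_rev]; omega
      simp only [h, h', if_true, if_false]
      have := h2 i.rev
      rw [hrev, neg_neg] at this
      linear_combination this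

/-- The relations leave one free parameter for each of the `n + 1` pairs of opposite roots. With the
mass at the origin there are as many unknowns as equations, so that solvability follows from
uniqueness. -/
theorem IsPolynomialDistribution.exists_systemMap_eq {β : Measure ℝ}
    (hβ : IsPolynomialDistribution n c β) (hμ : 0 < μ) (hr : Function.Injective r)
    (hroot : ∀ i, (charPoly n c μ).IsRoot (r i)) (hrev : ∀ i, r i.rev = -r i) :
    ∃ (D : Fin (2 * n + 2) → ℂ) (p : ℂ),
      (∀ i, D i * r i ^ n * (r i - μ) =
        Complex.exp (-r i) * D i.rev * ∑ j ∈ Finset.range n, (nu n c μ j : ℂ) * r i ^ j) ∧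
      systemMap n c μ r (D, p) = (0, 1) := by
  obtain ⟨a, ha, harel⟩ := exists_relation_solution hroot hrev
  set T : (Fin (n + 1) → ℂ) →ₗ[ℂ] (Fin (2 * n + 2) → ℂ) :=
    LinearMap.pi fun i => a i • LinearMap.proj (pairIndex i) with hT
  have hTapply : ∀ t i, T t i = a i * t (pairIndex i) := fun t i => rfl
  have hTrel : ∀ t i, T t i * r i ^ n * (r i - μ) = Complex.exp (-r i) * T t i.rev *
      ∑ j ∈ Finset.range n, (nu n c μ j : ℂ) * r i ^ j := by
    intro t i
    rw [hTapply, hTapply, pairIndex_rev]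
    linear_combination t (pairIndex i) * harel i
  have hTinj : ∀ t, T t = 0 → t = 0 := by
    intro t ht
    funext k
    set i : Fin (2 * n + 2) := ⟨k, by omega⟩ with hi
    have hk : pairIndex i = k := by
      ext
      simp only [pairIndex, hi]
      omega
    have h1 : a i * t k = 0 := by rw [← hk, ← hTapply, ht]; rfl
    have h2 : a i.rev * t k = 0 := by rw [← hk, ← pairIndex_rev, ← hTapply, ht]; rfl
    rcases ha i with h | h
    · exact (mul_eq_zero.1 h1).resolve_left h
    · exact (mul_eq_zero.1 h2).resolve_left h
  have hsurj : Function.Surjective (systemMap n c μ r ∘ₗ T.prodMap LinearMap.id) := by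
    rw [← LinearMap.injective_iff_surjective, ← LinearMap.ker_eq_bot, LinearMap.ker_eq_bot']
    rintro ⟨t, p⟩ h
    obtain ⟨h1, h2⟩ := hβ.eq_zero_of_systemMap_eq_zero hμ hr hrev (hTrel t) (p := p) h
    rw [hTinj t h1, h2]
    rfl
  obtain ⟨⟨t, p⟩, h⟩ := hsurj (0, 1)
  exact ⟨T t, p, hTrel t, h⟩

namespace IsCharacteristicData

theorem ne_zero (h : IsCharacteristicData n c μ r ζ θ) (i : Fin (2 * n + 2)) : r i ≠ 0 := by
  intro hi
  have h1 : i.rev = i := h.injective (by rw [h.rev, hi, neg_zero])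
  have h2 := congrArg Fin.val h1
  rw [Fin.val_rev] at h2
  omega

/-- Where `ζ i = 0`, the root is `-μ` and a zero of `∑ ν_j r ^ j`, so that the relation forces the
coefficient to vanish. -/
theorem eq_zero_of_relation (h : IsCharacteristicData n c μ r ζ θ) (hμ : 0 < μ)
    {i : Fin (2 * n + 2)} (hi : ζ i = 0)
    (hrel : D i * r i ^ n * (r i - μ) =
      Complex.exp (-r i) * D i.rev * ∑ j ∈ Finset.range n, (nu n c μ j : ℂ) * r i ^ j) :
    D i = 0 := by
  have hθ : θ i ≠ 0 := (h.nontrivial i).resolve_left (not_not.2 hi)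
  have h0 := h.ne_zero i
  have h1 := h.first i
  have h2 := h.second i
  rw [hi] at h1 h2
  simp only [zero_mul, mul_zero, zero_add, Finset.sum_const_zero, add_zero] at h1 h2
  have hP : ∑ j ∈ Finset.range n, (nu n c μ j : ℂ) * r i ^ j = 0 := by
    have h3 : θ i * ∑ j ∈ Finset.range n, (nu n c μ j : ℂ) * r i ^ j = 0 := by
      rw [h1, Finset.mul_sum]
      exact Finset.sum_congr rfl fun j _ => by ring
    exact (mul_eq_zero.1 h3).resolve_left hθ
  have hri : r i = -μ := by
    have h3 : θ i * r i ^ n * (r i + μ) = 0 := by linear_combination h2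
    exact eq_neg_of_add_eq_zero_left
      ((mul_eq_zero.1 h3).resolve_left (mul_ne_zero hθ (pow_ne_zero n h0)))
  rw [hP, mul_zero] at hrel
  have hsub : r i - μ ≠ 0 := by
    rw [hri]
    intro h3
    have h4 : (μ : ℂ) = 0 := by linear_combination (-1 / 2 : ℂ) * h3
    exact hμ.ne' (by exact_mod_cast h4)
  exact (mul_eq_zero.1 ((mul_eq_zero.1 hrel).resolve_right hsub)).resolve_right
    (pow_ne_zero n h0)

end IsCharacteristicData

end

/-! ### Conclusion -/

namespace IsSteadyState

variable {n : ℕ} {c : ℕ → ℝ} {μ : ℝ} {β w : Measure ℝ}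

/-- A continuous solution of total mass one of the integral equation is given by the atom and the
density of any steady state. -/
theorem eq_of_gapKernel_equation (hw : IsSteadyState μ β w) (hβ : IsPolynomialDistribution n c β)
    (hμ : 0 < μ) {f : ℝ → ℂ} (hf : Continuous f) {p : ℂ}
    (heq : ∀ x ∈ Set.Icc (0 : ℝ) 1,
      f x = p * gapKernel n c μ x + ∫ s in (0 : ℝ)..1, gapKernel n c μ (x + s) * f s)
    (hm : p + ∫ x in (0 : ℝ)..1, f x = 1) :
    p = w.real {0} ∧ ∀ x ∈ Set.Icc (0 : ℝ) 1, f x = stepDensity n c μ w x := by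
  have := hw.isProbabilityMeasure
  have cg := continuous_stepDensity n c μ w
  have cκ := continuous_gapKernel (n := n) (c := c) (μ := μ)
  have cg' : Continuous fun x => (stepDensity n c μ w x : ℂ) := by fun_prop
  have heq' : ∀ x ∈ Set.Icc (0 : ℝ) 1, f x - stepDensity n c μ w x =
      (p - w.real {0}) * gapKernel n c μ x +
        ∫ s in (0 : ℝ)..1, gapKernel n c μ (x + s) * (f s - stepDensity n c μ w s) := by
    intro x hx
    have h3 := congrArg (fun x : ℝ => (x : ℂ)) (hw.stepDensity_eq hβ hμ x)
    simp only [Complex.ofReal_add, Complex.ofReal_mul, ← intervalIntegral.integral_ofReal] at h3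
    simp only [mul_sub]
    rw [intervalIntegral.integral_sub (Continuous.intervalIntegrable (by fun_prop) _ _)
      (Continuous.intervalIntegrable (by fun_prop) _ _)]
    linear_combination heq x hx - h3
  have hm' : (p - w.real {0}) + ∫ x in (0 : ℝ)..1, (f x - stepDensity n c μ w x) = 0 := by
    have h3 := congrArg (fun x : ℝ => (x : ℂ)) (hw.real_zero_add_integral hβ hμ)
    simp only [Complex.ofReal_add, ← intervalIntegral.integral_ofReal, Complex.ofReal_one] at h3
    rw [intervalIntegral.integral_sub (hf.intervalIntegrable _ _) (cg'.intervalIntegrable _ _)]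
    linear_combination hm - h3
  obtain ⟨h1, h2⟩ := hβ.eq_zero_of_gapKernel_equation hμ (by fun_prop) heq' hm'
  exact ⟨sub_eq_zero.1 h1, fun x hx => sub_eq_zero.1 (h2 x hx)⟩

theorem unique (hβ : IsPolynomialDistribution n c β) (hμ : 0 < μ) {w' : Measure ℝ}
    (hw : IsSteadyState μ β w) (hw' : IsSteadyState μ β w') : w' = w := by
  have := hw'.isProbabilityMeasure
  have heq := fun x => congrArg (fun x : ℝ => (x : ℂ)) (hw'.stepDensity_eq hβ hμ x)
  have hm := congrArg (fun x : ℝ => (x : ℂ)) (hw'.real_zero_add_integral hβ hμ)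
  simp only [Complex.ofReal_add, Complex.ofReal_mul, ← intervalIntegral.integral_ofReal,
    Complex.ofReal_one] at heq hm
  obtain ⟨h1, h2⟩ := hw.eq_of_gapKernel_equation hβ hμ
    (Complex.continuous_ofReal.comp (continuous_stepDensity n c μ w')) (fun x _ => heq x) hm
  rw [hw.eq_dirac_add_withDensity hβ hμ, hw'.eq_dirac_add_withDensity hβ hμ,
    Complex.ofReal_injective h1]
  congr 1
  refine withDensity_congr_ae ?_
  filter_upwards [ae_restrict_mem measurableSet_Icc] with x hx
  rw [Complex.ofReal_injective (h2 x hx)]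

end IsSteadyState

end AlternatingLindley

end

open AlternatingLindley

theorem theorem1 (n : ℕ) (c : ℕ → ℝ) (μ : ℝ) (hμ : 0 < μ) (β : MeasureTheory.Measure ℝ)
    (hβ : AlternatingLindley.IsPolynomialDistribution n c β)
    (hsimple : (AlternatingLindley.charPoly n c μ).roots.Nodup) :
    (∃! w : MeasureTheory.Measure ℝ, AlternatingLindley.IsSteadyState μ β w) ∧
    (∃ r ζ θ : Fin (2 * n + 2) → ℂ, AlternatingLindley.IsCharacteristicData n c μ r ζ θ) ∧
    ∀ w : MeasureTheory.Measure ℝ, AlternatingLindley.IsSteadyState μ β w →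
    ∀ r ζ θ : Fin (2 * n + 2) → ℂ, AlternatingLindley.IsCharacteristicData n c μ r ζ θ →
      (∀ i, r i ≠ 0) ∧
      0 < w.real {0} ∧
      ∃ d : Fin (2 * n + 2) → ℂ,
        -- the density on `[0,1]` and the atom at the origin
        (∃ f : ℝ → ℝ,
          (∀ x ∈ Set.Icc (0 : ℝ) 1, 0 ≤ f x ∧
            (f x : ℂ) = ∑ i, d i * ζ i * Complex.exp (r i * x)) ∧
          w = ENNReal.ofReal (w.real {0}) • MeasureTheory.Measure.dirac 0 +
            (MeasureTheory.volume.restrict (Set.Icc (0 : ℝ) 1)).withDensity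
              (fun x => ENNReal.ofReal (f x))) ∧
        ((w.real {0} : ℝ) : ℂ) = 1 - ∑ i, d i * ζ i / r i * (Complex.exp (r i) - 1) ∧
        -- the linear system holds, and it determines `π₀` and the products `d i * ζ i`
        AlternatingLindley.SolvesLinearSystem n c μ r ζ d ((w.real {0} : ℝ) : ℂ) ∧
        ∀ (d' : Fin (2 * n + 2) → ℂ) (p' : ℂ),
          AlternatingLindley.SolvesLinearSystem n c μ r ζ d' p' →
            p' = ((w.real {0} : ℝ) : ℂ) ∧ ∀ i, d' i * ζ i = d i * ζ i := by
  obtain ⟨w₀, hw₀⟩ := hβ.exists_isSteadyState hμ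
  refine ⟨⟨w₀, hw₀, fun w' hw' => hw₀.unique hβ hμ hw'⟩, exists_isCharacteristicData hsimple, ?_⟩
  intro w hw r ζ θ h
  have := hw.isProbabilityMeasure
  obtain ⟨D, p, hrel, hsys⟩ := hβ.exists_systemMap_eq hμ h.injective h.isRoot h.rev
  set d : Fin (2 * n + 2) → ℂ := fun i => D i / ζ i with hd
  have hdζ : d * ζ = D := by
    funext i
    by_cases hi : ζ i = 0
    · simp [hi, h.eq_zero_of_relation hμ hi (hrel i)]
    · simp [hd, hi]
  have hsolve : SolvesLinearSystem n c μ r ζ d p := by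
    rw [solvesLinearSystem_iff, hdζ, ← polyCorr_one_zero]
    exact ⟨hrel, fun l hl => congrFun (congrArg Prod.fst hsys) ⟨l, Nat.lt_succ_of_le hl⟩,
      congrArg Prod.snd hsys⟩
  have hall : ∀ (d' : Fin (2 * n + 2) → ℂ) (p' : ℂ), SolvesLinearSystem n c μ r ζ d' p' →
      p' = ((w.real {0} : ℝ) : ℂ) ∧
        ∀ x ∈ Set.Icc (0 : ℝ) 1, expSum r 1 (d' * ζ) 0 x = stepDensity n c μ w x := by
    intro d' p' hs
    obtain ⟨h1, h2, h3⟩ := solvesLinearSystem_iff.1 hs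
    exact hw.eq_of_gapKernel_equation hβ hμ (continuous_expSum 0)
      (fun x hx => gapKernel_equation hβ.eval_one h.rev h1 h2 hx) h3
  obtain ⟨hp, hf⟩ := hall d p hsolve
  subst hp
  refine ⟨h.ne_zero, hw.real_zero_pos hβ hμ, d, ⟨stepDensity n c μ w, fun x hx => ⟨
    hw.stepDensity_nonneg hβ hμ x, ?_⟩, hw.eq_dirac_add_withDensity hβ hμ⟩, ?_, hsolve, ?_⟩
  · rw [← hf x hx, ← expSum_eq_one]
    simp [expSum]
  · rw [hsolve.normalisation]
    congr 1
    simp only [expSum_eq_one (r := r) (ζ := ζ)]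
    have h1 := integral_mul_expSum (r := r) (D := d * ζ) (P := fun _ => 1) continuous_const 0 1
    simp only [one_mul] at h1
    rw [h1]
    refine Finset.sum_congr rfl fun i _ => ?_
    rw [integral_exp_mul_complex (h.ne_zero i)]
    simp
    ring
  · intro d' p' hs
    obtain ⟨hp', hf'⟩ := hall d' p' hs
    refine ⟨hp', fun i => ?_⟩
    have h0 : d' * ζ + (-1 : ℂ) • (d * ζ) = 0 :=
      eq_zero_of_expSum_eq_zero h.injective fun x hx => by
      rw [expSum_add, expSum_smul, hf' x hx, hf x hx]
      ring
    have := congrFun h0 i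
    simp only [Pi.add_apply, Pi.smul_apply, Pi.mul_apply, Pi.zero_apply, smul_eq_mul] at this
    linear_combination this
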